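/- \textbf{Setting.} An SMDP consists of nonempty finite sets $S$ (states) and $X$ (actions), a nonempty-valued correspondence $\Gamma:S\to 2^X$ with graph $Gr(\Gamma)$, an initial distribution $q_0\in\Delta(S)$, a transition function $Q:Gr(\Gamma)\to\Delta(S)$, a payoff $\pi:Gr(\Gamma)\times S\to\mathbb R$, a discount factor $\delta\in[0,1)$, and a family $Q_\theta:Gr(\Gamma)\to\Delta(S)$, $\theta\in\Theta\neq\emptyset$. It is \emph{regular} if $\Theta$ is a compact subset of a Euclidean space, $\theta\mapsto Q_\theta(s'\mid s,x)$ is continuous for all $(s,x)\in Gr(\Gamma)$, $s'\in S$, and there is a dense $\hat\Theta\subseteq\Theta$ such that for all $\theta\in\hat\Theta$, $Q(s'\mid s,x)>0$ implies $Q_\theta(s'\mid s,x)>0$. For $m\in\Delta(Gr(\Gamma))$ let $$K_Q(m,\theta)=\sum_{(s,x)\in Gr(\Gamma)}m(s,x)\sum_{s'}Q(s'\mid s,x)\ln\frac{Q(s'\mid s,x)}{Q_\theta(s'\mid s,x)}\in[0,\infty]$$ (with $0\ln(0/q)=0$, $p\ln(p/0)=\infty$ for $p>0$, $0\cdot\infty=0$)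 and $\Theta_Q(m)=\arg\min_{\theta\in\Theta}K_Q(m,\theta)$. The SMDP is \emph{weakly identified} if for all $m\in\Delta(Gr(\Gamma))$ and $\theta,\theta'\in\Theta_Q(m)$, $Q_\theta(\cdot\mid s,x)=Q_{\theta'}(\cdot\mid s,x)$ whenever $m(s,x)>0$. It satisfies \emph{full communication} if for all $s_0,s'\in S$ there are $n\ge 0$, states $s_1,\dots,s_n$ and actions $x_0,\dots,x_n$ with $x_i\in\Gamma(s_i)$ for $i=0,\dots,n$ and $Q(s'\mid s_n,x_n)Q(s_n\mid s_{n-1},x_{n-1})\cdots Q(s_1\mid s_0,x_0)>0$. \textbf{Equilibrium.} $\Sigma$ is the set of strategies $\sigma:S\to\Delta(X)$ with $\sigma(\cdot\mid s)$ supported in $\Gamma(s)$, and $\Sigma^\varepsilon=\{\sigma\in\Sigma:\sigma(x\mid s)\ge\varepsilon\ \forall (s,x)\in Gr(\Gamma)\}$. For a belief $\mu\in\Delta(\Theta)$ let $\bar Q_\mu=\int_\Theta Q_\theta\,\mu(d\theta)$. A pair $(\sigma,m)\in\Sigma^\varepsilon\times\Delta(Gr(\Gamma))$ is a \emph{Berk--Nash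 equilibrium with exhaustive learning of the $\varepsilon$-perturbed SMDP} if there is $\mu\in\Delta(\Theta)$ such that: (i) $\sigma$ is optimal, among strategies in $\Sigma^\varepsilon$, for the MDP with transition function $\bar Q_\mu$; that is, for some $V:S\to\mathbb R$ and all $s$, $$V(s)=\max_{\tau\in\Sigma^\varepsilon}\sum_{x\in\Gamma(s)}\tau(x\mid s)\sum_{s'}\{\pi(s,x,s')+\delta V(s')\}\bar Q_\mu(s'\mid s,x),$$ and $\sigma$ attains the maximum; (ii) $\mu(\Theta_Q(m))=1$; (iii) $m(s',x')=\sum_{(s,x)\in Gr(\Gamma)}\sigma(x'\mid s')Q(s'\mid s,x)m(s,x)$ for all $(s',x')\in Gr(\Gamma)$; (iv) for all $(s,x)\in Gr(\Gamma)$ and $s'$ with $\bar Q_\mu(s'\mid s,x)>0$, $\mu$ equals its Bayesian update: $\mu(A)=\int_A Q_\theta(s'\mid s,x)\mu(d\theta)/\bar Q_\mu(s'\mid s,x)$ for all Borel $A\subseteq\Theta$. A pair $(\sigma,m)\in\Sigma\times\Delta(Gr(\Gamma))$ is a \emph{perfect Berk--Nash equilibrium} of the SMDP if there are rationals $\varepsilon_n>0$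 with $\varepsilon_n\to0$ and Berk--Nash equilibria with exhaustive learning $(\sigma_n,m_n)$ of the $\varepsilon_n$-perturbed SMDPs with $(\sigma_n,m_n)\to(\sigma,m)$. \textbf{Theorem.} Every regular SMDP that is weakly identified and satisfies full communication has a perfect Berk--Nash equilibrium. -/

import Mathlib

open Filter Topology MeasureTheory

noncomputable section

/-- The graph `Gr(Γ)` of a constraint correspondence `Γ : S → 2^X`. -/
abbrev Gr {S X : Type*} (Γ : S → Finset X) : Type _ :=
  {p : S × X // p.2 ∈ Γ p.1}

/-- A finite Markov decision process with states `S` and actions `X`. -/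
structure MDP (S X : Type*) [Fintype S] [Fintype X] where
  /-- the set of feasible actions at each state -/
  Γ : S → Finset X
  Γ_nonempty : ∀ s, (Γ s).Nonempty
  /-- the distribution of the initial state -/
  q₀ : S → ℝ
  q₀_mem : q₀ ∈ stdSimplex ℝ S
  /-- the true transition probability function; `Q (s, x) s'` is `Q(s' | s, x)` -/
  Q : Gr Γ → S → ℝ
  Q_mem : ∀ z, Q z ∈ stdSimplex ℝ S
  /-- the per-period payoff; `payoff (s, x) s'` is `π(s, x, s')` -/
  payoff : Gr Γ → S → ℝ
  /-- the discount factor -/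
  δ : ℝ
  δ_nonneg : 0 ≤ δ
  δ_lt_one : δ < 1

/-- A subjective Markov decision process: an MDP together with a nonempty family of transition
probability functions, indexed by a subset `Θ` of a Euclidean space. -/
structure SMDP (S X : Type*) [Fintype S] [Fintype X] (k : ℕ) extends MDP S X where
  Θ : Set (EuclideanSpace ℝ (Fin k))
  Θ_nonempty : Θ.Nonempty
  /-- the subjective models; `Qθ θ (s, x) s'` is `Q_θ(s' | s, x)` -/
  Qθ : Θ → Gr Γ → S → ℝ
  Qθ_mem : ∀ θ z, Qθ θ z ∈ stdSimplex ℝ S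

namespace MDP

variable {S X : Type*} [Fintype S] [Fintype X] [DecidableEq X] (M : MDP S X)

/-- The set `Σ` of strategies `σ : S → Δ(X)`, where `σ(s)` is supported in `Γ(s)`;
`σ s x` is `σ(x | s)`. -/
def strategies : Set (S → X → ℝ) :=
  {σ | ∀ s, σ s ∈ stdSimplex ℝ X ∧ ∀ x, x ∉ M.Γ s → σ s x = 0}

/-- The set `Σ^ε` of strategies that put mass at least `ε` on every feasible action. -/
def perturbedStrategies (ε : ℝ) : Set (S → X → ℝ) :=
  {σ | σ ∈ M.strategies ∧ ∀ s, ∀ x ∈ M.Γ s, ε ≤ σ s x}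

/-- `∫ {π(s, x, s') + δ V(s')} R(ds' | s, x)` for a transition function `R`
and a continuation value `V`. -/
def actionValue (R : Gr M.Γ → S → ℝ) (V : S → ℝ) (z : Gr M.Γ) : ℝ :=
  ∑ s', (M.payoff z s' + M.δ * V s') * R z s'

/-- The value at `s` of drawing today's action from `σ(· | s)`, with continuation value `V`. -/
def mixedValue (R : Gr M.Γ → S → ℝ) (V : S → ℝ) (σ : S → X → ℝ) (s : S) : ℝ :=
  ∑ x : {x // x ∈ M.Γ s}, σ s x * M.actionValue R V ⟨(s, x), x.2⟩

/-- `V` solves the Bellman equation of the MDP with transition function `R` in which strategies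
are restricted to `Σ^ε`: `V(s)` is the maximum over `σ ∈ Σ^ε` of the value of `σ(· | s)`. -/
def IsBellmanSolution (ε : ℝ) (R : Gr M.Γ → S → ℝ) (V : S → ℝ) : Prop :=
  ∀ s, IsGreatest ((fun σ => M.mixedValue R V σ s) '' M.perturbedStrategies ε) (V s)

/-- `σ` is an optimal strategy of the MDP with transition function `R` in which strategies are
restricted to `Σ^ε`: at every state `σ(· | s)` attains the maximum in the Bellman equation. -/
def IsOptimal (ε : ℝ) (R : Gr M.Γ → S → ℝ) (σ : S → X → ℝ) : Prop :=
  σ ∈ M.perturbedStrategies ε ∧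
    ∃ V : S → ℝ, M.IsBellmanSolution ε R V ∧ ∀ s, M.mixedValue R V σ s = V s

/-- `M_{σ,Q}(s', x' | s, x) = σ(x' | s') Q(s' | s, x)`, for the true transition function. -/
def kernel (σ : S → X → ℝ) (z' z : Gr M.Γ) : ℝ :=
  σ z'.1.1 z'.1.2 * M.Q z z'.1.1

/-- `m ∈ I_Q(σ)`: `m` is a probability distribution on `Gr(Γ)` with `m = M_{σ,Q}[m]`. -/
def IsStationary (σ : S → X → ℝ) (m : Gr M.Γ → ℝ) : Prop :=
  m ∈ stdSimplex ℝ (Gr M.Γ) ∧ ∀ z', m z' = ∑ z, M.kernel σ z' z * m z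

/-- Full communication: every state can be reached from every state, along a finite sequence of
states and feasible actions that has positive probability. -/
def FullCommunication : Prop :=
  ∀ s₀ s' : S, ∃ (n : ℕ) (z : Fin (n + 1) → Gr M.Γ), (z 0).1.1 = s₀ ∧
    0 < M.Q (z (Fin.last n)) s' * ∏ i : Fin n, M.Q (z i.castSucc) (z i.succ).1.1

end MDP

/-- The Kullback-Leibler divergence `E_p[ln (p / q)]` of probability vectors on a finite set, with
`p ln (p / 0) = ∞` for `p > 0` and `0 ln (0 / q) = 0`. -/
def klDivergence {S : Type*} [Fintype S] (p q : S → ℝ) : EReal :=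
  open Classical in
  if ∃ s, 0 < p s ∧ q s = 0 then ⊤ else ((∑ s, p s * Real.log (p s / q s) : ℝ) : EReal)

namespace SMDP

variable {S X : Type*} [Fintype S] [Fintype X] [DecidableEq X] {k : ℕ} (P : SMDP S X k)

/-- Regularity: `Θ` is compact, `Q_θ` is continuous in `θ`, and, for a dense set of parameters,
every transition that has positive probability under `Q` has positive probability under `Q_θ`. -/
structure IsRegular : Prop where
  isCompact : IsCompact P.Θ
  continuous : ∀ z s', Continuous fun θ => P.Qθ θ z s'
  dense : ∃ D : Set P.Θ, Dense D ∧ ∀ θ ∈ D, ∀ z s', 0 < P.Q z s' → 0 < P.Qθ θ z s'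

/-- The weighted Kullback-Leibler divergence `K_Q(m, θ)`; `0 * ∞ = 0`. -/
def wKLD (m : Gr P.Γ → ℝ) (θ : P.Θ) : EReal :=
  ∑ z, klDivergence (P.Q z) (P.Qθ θ z) * (m z : EReal)

/-- The set `Θ_Q(m)` of closest parameter values given `m`. -/
def closestParams (m : Gr P.Γ → ℝ) : Set P.Θ :=
  {θ | ∀ θ', P.wKLD m θ ≤ P.wKLD m θ'}

/-- Weak identification: for every `m`, all closest parameter values induce the same transition
probabilities at every `(s, x)` with `m(s, x) > 0`. -/
def WeaklyIdentified : Prop :=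
  ∀ m ∈ stdSimplex ℝ (Gr P.Γ), ∀ θ ∈ P.closestParams m, ∀ θ' ∈ P.closestParams m,
    ∀ z, 0 < m z → P.Qθ θ z = P.Qθ θ' z

/-- The subjective transition function `Q̄_μ = ∫ Q_θ μ(dθ)`. -/
def meanQ (μ : ProbabilityMeasure P.Θ) (z : Gr P.Γ) (s' : S) : ℝ :=
  ∫ θ, P.Qθ θ z s' ∂(μ : Measure P.Θ)

/-- The Bayesian operator: `B(s, x, s', μ)(A)`, where `z = (s, x)`; it is used for
`Q̄_μ(s' | s, x) > 0` only. -/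
def bayes (z : Gr P.Γ) (s' : S) (μ : ProbabilityMeasure P.Θ) (A : Set P.Θ) : ℝ :=
  (∫ θ in A, P.Qθ θ z s' ∂(μ : Measure P.Θ)) / P.meanQ μ z s'

/-- The belief `μ` supports `(σ, m)` as a Berk-Nash equilibrium of the `ε`-perturbed SMDP. -/
structure Supports (ε : ℝ) (μ : ProbabilityMeasure P.Θ) (σ : S → X → ℝ) (m : Gr P.Γ → ℝ) :
    Prop where
  optimal : P.IsOptimal ε (P.meanQ μ) σ
  belief : ∀ᵐ θ ∂(μ : Measure P.Θ), θ ∈ P.closestParams m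
  stationary : P.IsStationary σ m

/-- Exhaustive learning: whatever state, action and new state that the agent deems possible are
observed, updating leaves the belief `μ` unchanged. -/
def ExhaustiveLearning (μ : ProbabilityMeasure P.Θ) : Prop :=
  ∀ z s', 0 < P.meanQ μ z s' →
    ∀ A : Set P.Θ, MeasurableSet A → (μ : Measure P.Θ).real A = P.bayes z s' μ A

/-- `(σ, m)` is a Berk-Nash equilibrium with exhaustive learning of the `ε`-perturbed SMDP. -/
def IsBerkNashExhaustive (ε : ℝ) (σ : S → X → ℝ) (m : Gr P.Γ → ℝ) : Prop :=
  ∃ μ : ProbabilityMeasure P.Θ, P.Supports ε μ σ m ∧ P.ExhaustiveLearning μ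

/-- `(σ, m) ∈ Σ × Δ(Gr(Γ))` is a perfect Berk-Nash equilibrium: a limit, as `ε → 0` along positive
rationals, of Berk-Nash equilibria with exhaustive learning of the `ε`-perturbed SMDPs. -/
def IsPerfectBerkNash (σ : S → X → ℝ) (m : Gr P.Γ → ℝ) : Prop :=
  σ ∈ P.strategies ∧ m ∈ stdSimplex ℝ (Gr P.Γ) ∧
    ∃ (ε : ℕ → ℚ) (σs : ℕ → S → X → ℝ) (ms : ℕ → Gr P.Γ → ℝ),
      (∀ n, 0 < ε n) ∧ Tendsto ε atTop (𝓝 0) ∧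
      (∀ n, P.IsBerkNashExhaustive (ε n : ℝ) (σs n) (ms n)) ∧
      Tendsto σs atTop (𝓝 σ) ∧ Tendsto ms atTop (𝓝 m)

end SMDP

end

/-! An equilibrium of the ε-perturbed problem is a fixed point of a loop strategy → stationary
distribution → best-fitting model → value → best reply, and each arrow but the last can be made a
continuous function.

Strategies in Σ^ε use every feasible action, so under full communication the stationary distribution
is unique and has full support; uniqueness plus compactness gives continuity
(`MDP.exists_continuous_stationary`). Against such a distribution weak identification makes all
closest parameters induce one transition function, which is therefore continuous too, although the
parameter need not be (`SMDP.exists_continuous_closest`). The Bellman operator is a contraction, so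
the value is continuous in the transition function (`MDP.exists_continuous_value`). Action values
are thus continuous in the strategy, and Nash's theorem with the states as players
(`exists_nash_simplexProduct`) yields a strategy optimal against the values it generates. The belief
is a point mass at a closest parameter; Bayes' rule never moves it, whence exhaustive learning.
Compactness then gives a limit as ε → 0.

Nash's theorem comes from Brouwer's, and Brouwer's from Scarf's lemma
(`Scarf.exists_colorful_dominant`), a parity count on a grid. -/

/-! ### Scarf's lemma on dominant sets. -/

namespace Scarf

variable {I V : Type*}

/-- With respect to the utilities `u i`, no point strictly beats `A` in every coordinate. -/
def IsDominant (u : I → V → ℤ) (A : Finset V) : Prop :=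
  ∀ y, ∃ i, ∀ x ∈ A, u i y ≤ u i x

/-- `x` is `u a`-maximal among the points that beat `m j` in every coordinate `j ≠ a`. -/
def IsReplacement (u : I → V → ℤ) (m : I → V) (a : I) (x : V) : Prop :=
  (∀ j, j ≠ a → u j (m j) < u j x) ∧
    ∀ y, (∀ j, j ≠ a → u j (m j) < u j y) → u a y ≤ u a x

/-- A map whose image has one element less than its domain identifies exactly one pair. -/
theorem exists_unique_collision {α β : Type*} [DecidableEq β] (f : α → β)
    (A : Finset α) (h : (A.image f).card + 1 = A.card) :
    ∃ a ∈ A, ∃ b ∈ A, a ≠ b ∧ f a = f b ∧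
      ∀ y ∈ A, ∀ z ∈ A, f y = f z → y ≠ z → (y = a ∧ z = b) ∨ (y = b ∧ z = a) := by
  classical
  obtain ⟨a, ha, b, hb, hab, hf⟩ : ∃ a ∈ A, ∃ b ∈ A, a ≠ b ∧ f a = f b :=
    Finset.exists_ne_map_eq_of_card_lt_of_maps_to (t := A.image f) (by omega)
      (fun x hx => Finset.mem_image_of_mem f hx)
  have key : ∀ a ∈ A, ∀ b ∈ A, a ≠ b → f a = f b → Set.InjOn f (A.erase a) := by
    intro a ha b hb hab hf
    apply Finset.injOn_of_card_image_eq
    have : (A.erase a).image f = A.image f := by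
      apply Finset.Subset.antisymm (Finset.image_subset_image (Finset.erase_subset _ _))
      intro c hc
      obtain ⟨x, hx, rfl⟩ := Finset.mem_image.1 hc
      by_cases hxa : x = a
      · subst hxa
        rw [hf]
        exact Finset.mem_image_of_mem _ (Finset.mem_erase.2 ⟨hab.symm, hb⟩)
      · exact Finset.mem_image_of_mem _ (Finset.mem_erase.2 ⟨hxa, hx⟩)
    rw [this, Finset.card_erase_of_mem ha]
    omega
  have ka := key a ha b hb hab hf
  have kb := key b hb a ha hab.symm hf.symm
  refine ⟨a, ha, b, hb, hab, hf, fun y hy z hz hyz hne => ?_⟩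
  have h1 : y = a ∨ z = a := by
    by_contra! hcon
    exact hne (ka (by simp [hy, hcon]) (by simp [hz, hcon]) hyz)
  have h2 : y = b ∨ z = b := by
    by_contra! hcon
    exact hne (kb (by simp [hy, hcon]) (by simp [hz, hcon]) hyz)
  grind

/-- Only the two points of the unique colour collision can go without losing a colour. In the parity
count: a room has exactly two doors. -/
theorem card_erase_image_eq {I V : Type*} [DecidableEq I] [DecidableEq V] (c : V → I)
    (A : Finset V) (C : Finset I) (hA : A.image c = C) (hcard : C.card + 1 = A.card) :
    (A.filter fun x => (A.erase x).image c = C).card = 2 := by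
  obtain ⟨a, ha, b, hb, hab, hf, H⟩ := exists_unique_collision c A (by rw [hA, hcard])
  rw [Finset.card_eq_two]
  refine ⟨a, b, hab, ?_⟩
  ext x
  simp only [Finset.mem_filter, Finset.mem_insert, Finset.mem_singleton]
  constructor
  · rintro ⟨hx, hx'⟩
    have : c x ∈ (A.erase x).image c := by
      rw [hx', ← hA]; exact Finset.mem_image_of_mem _ hx
    obtain ⟨z, hz, hzx⟩ := Finset.mem_image.1 this
    have hz' := Finset.mem_erase.1 hz
    rcases H z hz'.2 x hx hzx hz'.1 with h | h
    · exact Or.inr h.2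
    · exact Or.inl h.2
  · have main : ∀ a ∈ A, ∀ b ∈ A, a ≠ b → c a = c b → (A.erase a).image c = C := by
      intro a ha b hb hab hf
      rw [← hA]
      apply Finset.Subset.antisymm (Finset.image_subset_image (Finset.erase_subset _ _))
      intro d hd
      obtain ⟨x, hx, rfl⟩ := Finset.mem_image.1 hd
      by_cases hxa : x = a
      · subst hxa
        rw [hf]
        exact Finset.mem_image_of_mem _ (Finset.mem_erase.2 ⟨hab.symm, hb⟩)
      · exact Finset.mem_image_of_mem _ (Finset.mem_erase.2 ⟨hxa, hx⟩)
    rintro (rfl | rfl)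
    · exact ⟨ha, main _ ha _ hb hab hf⟩
    · exact ⟨hb, main _ hb _ ha hab.symm hf.symm⟩

section Door

variable {u : I → V → ℤ}

theorem exists_argmin (u : I → V → ℤ) {B : Finset V} (hne : B.Nonempty) :
    ∃ m : I → V, ∀ i, m i ∈ B ∧ ∀ x ∈ B, u i (m i) ≤ u i x := by
  have : ∀ i, ∃ z ∈ B, ∀ x ∈ B, u i z ≤ u i x := fun i => B.exists_min_image (u i) hne
  choose m hm using this
  exact ⟨m, hm⟩

/-- Dominance tested at a point of `B` itself gives a coordinate in which that point is the minimum.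
-/
theorem image_argmin [Fintype I] [DecidableEq V] {B : Finset V} (hu : ∀ i, Function.Injective (u i)) (hB : IsDominant u B)
    {m : I → V} (hm : ∀ i, m i ∈ B ∧ ∀ x ∈ B, u i (m i) ≤ u i x) :
    Finset.univ.image m = B := by
  ext w
  simp only [Finset.mem_image, Finset.mem_univ, true_and]
  constructor
  · rintro ⟨i, rfl⟩; exact (hm i).1
  · intro hw
    obtain ⟨i, hi⟩ := hB w
    exact ⟨i, hu i (le_antisymm ((hm i).2 w hw) (hi _ (hm i).1))⟩

theorem IsReplacement.unique (hu : ∀ i, Function.Injective (u i)) {m : I → V} {a : I} {x y : V}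
    (hx : IsReplacement u m a x) (hy : IsReplacement u m a y) : x = y :=
  hu a (le_antisymm (hy.2 x hx.1) (hx.2 y hy.1))

theorem exists_isReplacement [Finite V] {m : I → V} {a : I} {y : V}
    (hy : ∀ j, j ≠ a → u j (m j) < u j y) : ∃ x, IsReplacement u m a x := by
  classical
  have := Fintype.ofFinite V
  obtain ⟨x, hx, hmax⟩ := (Finset.univ.filter fun y => ∀ j, j ≠ a → u j (m j) < u j y).exists_max_image
    (u a) ⟨y, by simpa using hy⟩
  exact ⟨x, by simpa using hx, fun z hz => hmax z (by simpa using hz)⟩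

/-- A common replacement would beat the minimizers in all coordinates, against dominance. -/
theorem IsReplacement.ne {B : Finset V} (hB : IsDominant u B)
    {m : I → V} (hm : ∀ i, m i ∈ B ∧ ∀ x ∈ B, u i (m i) ≤ u i x) {a b : I} (hab : a ≠ b) {x y : V}
    (hx : IsReplacement u m a x) (hy : IsReplacement u m b y) : x ≠ y := by
  rintro rfl
  obtain ⟨i, hi⟩ := hB x
  have := hi _ (hm i).1
  by_cases hia : i = a
  · have := hy.1 i (by rw [hia]; exact hab)
    omega
  · have := hx.1 i hia
    omega

/-- As `m a = m b`, each point of `B` is `m j` for some `j ≠ a`, so `x`, which beats these, is new.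
Coordinates `j ≠ a` keep their minimizers; maximality of `x` in coordinate `a` handles the points
that beat them all. -/
theorem IsReplacement.isDominant_insert [Fintype I] [DecidableEq V] {B : Finset V} (hB : IsDominant u B)
    {m : I → V} (hm : ∀ i, m i ∈ B ∧ ∀ x ∈ B, u i (m i) ≤ u i x) (himg : Finset.univ.image m = B)
    {a b : I} (hab : a ≠ b) (hmab : m a = m b) {x : V} (hx : IsReplacement u m a x) :
    x ∉ B ∧ IsDominant u (insert x B) := by
  constructor
  · intro hxB
    rw [← himg] at hxB
    obtain ⟨j, -, hj⟩ := Finset.mem_image.1 hxB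
    by_cases hja : j = a
    · have := hx.1 b hab.symm
      rw [← hmab, ← hja, hj] at this
      exact lt_irrefl _ this
    · have := hx.1 j hja
      rw [hj] at this
      exact lt_irrefl _ this
  · intro y
    by_cases hy : ∀ j, j ≠ a → u j (m j) < u j y
    · refine ⟨a, fun w hw => ?_⟩
      rcases Finset.mem_insert.1 hw with rfl | hw
      · exact hx.2 y hy
      · obtain ⟨i, hi⟩ := hB y
        have hia : i = a := by
          by_contra hia
          exact absurd (hi _ (hm i).1) (not_le.2 (hy i hia))
        exact hia ▸ hi w hw
    · push Not at hy
      obtain ⟨j, hja, hj⟩ := hy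
      refine ⟨j, fun w hw => ?_⟩
      rcases Finset.mem_insert.1 hw with rfl | hw
      · exact hj.trans (hx.1 j hja).le
      · exact hj.trans ((hm j).2 w hw)

/-- The points that complete a dominant set with one collision of minimizers are the replacements
of the two colliding minimizers. -/
theorem isDominant_insert_iff [Fintype I] [DecidableEq V] {B : Finset V} (hB : IsDominant u B)
    {m : I → V} (hm : ∀ i, m i ∈ B ∧ ∀ x ∈ B, u i (m i) ≤ u i x) (himg : Finset.univ.image m = B)
    (hu : ∀ i, Function.Injective (u i)) {a b : I} (hab : a ≠ b) (hmab : m a = m b)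
    (H : ∀ y z, m y = m z → y ≠ z → (y = a ∧ z = b) ∨ (y = b ∧ z = a)) (x : V) :
    (x ∉ B ∧ IsDominant u (insert x B)) ↔ IsReplacement u m a x ∨ IsReplacement u m b x := by
  constructor
  · rintro ⟨hxB, hdom⟩
    -- `x` is the minimum in coordinate `i`, so each point of `B` is the minimum in another
    -- coordinate. Hence `m i` is also some `m k` with `k ≠ i`, which puts `i` in the colliding
    -- pair.
    obtain ⟨i, hi⟩ := hdom x
    have hxi : u i x < u i (m i) := by
      refine lt_of_le_of_ne (hi _ (Finset.mem_insert_of_mem (hm i).1)) fun h => hxB ?_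
      rw [hu i h]; exact (hm i).1
    have hw : ∀ w ∈ B, ∃ j, j ≠ i ∧ w = m j ∧ u j (m j) < u j x := by
      intro w hwB
      obtain ⟨j, hj⟩ := hdom w
      have h1 : w = m j := hu j (le_antisymm (hj _ (Finset.mem_insert_of_mem (hm j).1))
        ((hm j).2 w hwB))
      have h2 : u j (m j) < u j x := by
        refine lt_of_le_of_ne (h1 ▸ hj x (Finset.mem_insert_self _ _)) fun h => hxB ?_
        rw [← hu j h]; exact (hm j).1
      refine ⟨j, ?_, h1, h2⟩
      rintro rfl
      exact lt_asymm h2 hxi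
    have hlow : ∀ j, j ≠ i → u j (m j) < u j x := by
      intro j hji
      obtain ⟨l, hli, hl, hlx⟩ := hw (m j) (hm j).1
      obtain ⟨k, hki, hk, -⟩ := hw (m i) (hm i).1
      by_cases hjl : j = l
      · exact hjl ▸ hlx
      · have := H j l hl hjl
        have := H i k hk hki.symm
        grind
    have hrep : IsReplacement u m i x := by
      refine ⟨hlow, fun y hy => ?_⟩
      obtain ⟨l, hl⟩ := hdom y
      have hli : l = i := by
        by_contra hli
        exact absurd (hl _ (Finset.mem_insert_of_mem (hm l).1)) (not_le.2 (hy l hli))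
      exact hli ▸ hl x (Finset.mem_insert_self _ _)
    obtain ⟨k, hki, hk, -⟩ := hw (m i) (hm i).1
    rcases H i k hk hki.symm with ⟨h, -⟩ | ⟨h, -⟩
    · exact Or.inl (h ▸ hrep)
    · exact Or.inr (h ▸ hrep)
  · rintro (h | h)
    · exact h.isDominant_insert hB hm himg hab hmab
    · exact h.isDominant_insert hB hm himg hab.symm hmab.symm

variable {s : I → V}

/-- Both replacements exist because the slack points `s a` and `s b` are candidates: the non-slack
`t ∈ B` prevents `m j` from being the slack point of another coordinate. -/
theorem card_completions_eq_two [Fintype I] [Finite V] [DecidableEq V] [Nontrivial I] {B : Finset V} (hB : IsDominant u B)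
    (hu : ∀ i, Function.Injective (u i)) (hs : Function.Injective s)
    (hmin : ∀ i v, u i (s i) ≤ u i v)
    (hmax : ∀ i j v, j ≠ i → v ∉ Set.range s → u i v < u i (s j))
    (hcard : B.card + 1 = Fintype.card I) {t : V} (ht : t ∈ B) (hts : t ∉ Set.range s) :
    {x | x ∉ B ∧ IsDominant u (insert x B)}.ncard = 2 := by
  obtain ⟨m, hm⟩ := exists_argmin u ⟨t, ht⟩
  have himg := image_argmin hu hB hm
  obtain ⟨a, -, b, -, hab, hmab, H⟩ := exists_unique_collision m Finset.univ (by
    rw [himg, hcard, Finset.card_univ])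
  replace H := fun y z => H y (Finset.mem_univ _) z (Finset.mem_univ _)
  have ex : ∀ a, ∃ x, IsReplacement u m a x := by
    intro a
    refine exists_isReplacement (y := s a) fun j hja => ?_
    by_cases hj : m j ∈ Set.range s
    · obtain ⟨k, hk⟩ := hj
      have hkj : k = j := by
        by_contra hkj
        have h1 := hmax j k t hkj hts
        have h2 := (hm j).2 t ht
        rw [← hk] at h2
        omega
      subst hkj
      rw [← hk]
      exact lt_of_le_of_ne (hmin _ _) fun h => hja (hs (hu _ h))
    · exact hmax j a _ hja.symm hj
  obtain ⟨x, hx⟩ := ex a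
  obtain ⟨y, hy⟩ := ex b
  have hxy : x ≠ y := hx.ne hB hm hab hy
  rw [Set.ncard_eq_two]
  refine ⟨x, y, hxy, ?_⟩
  ext z
  rw [Set.mem_ofPred_eq, Set.mem_insert_iff, Set.mem_singleton_iff,
    isDominant_insert_iff hB hm himg hu hab hmab H]
  constructor
  · rintro (h | h)
    · exact Or.inl (h.unique hu hx)
    · exact Or.inr (h.unique hu hy)
  · rintro (rfl | rfl)
    · exact Or.inl hx
    · exact Or.inr hy

/-- Here `b` has no replacement: it would have to beat `s b` in coordinate `i₀`, hence be a slack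
point `s l` with `l ≠ b`, but `s l` is lowest in coordinate `l`. -/
theorem card_completions_eq_one [Fintype I] [DecidableEq I] [Finite V] [DecidableEq V] [Nontrivial I]
    (hu : ∀ i, Function.Injective (u i)) (hs : Function.Injective s)
    (hmin : ∀ i v, u i (s i) ≤ u i v)
    (hmax : ∀ i j v, j ≠ i → v ∉ Set.range s → u i v < u i (s j))
    {t : V} (hts : t ∉ Set.range s) (i₀ : I)
    (hB : IsDominant u ((Finset.univ.erase i₀).image s)) :
    {x | x ∉ (Finset.univ.erase i₀).image s ∧
      IsDominant u (insert x ((Finset.univ.erase i₀).image s))}.ncard = 1 := by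
  set B := (Finset.univ.erase i₀).image s with hBdef
  have hsB : ∀ j, j ≠ i₀ → s j ∈ B := fun j hj => Finset.mem_image_of_mem _ (by simp [hj])
  have hcard : B.card + 1 = Fintype.card I := by
    rw [hBdef, Finset.card_image_of_injective _ hs, Finset.card_erase_of_mem (Finset.mem_univ _),
      Finset.card_univ]
    have := Fintype.card_pos (α := I)
    omega
  obtain ⟨k, hk⟩ := exists_ne i₀
  obtain ⟨m, hm⟩ := exists_argmin u ⟨s k, hsB k hk⟩
  have himg := image_argmin hu hB hm
  have hms : ∀ j, j ≠ i₀ → m j = s j := fun j hj =>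
    hu j (le_antisymm ((hm j).2 _ (hsB j hj)) (hmin _ _))
  obtain ⟨b, hb, hmb⟩ : ∃ b, b ≠ i₀ ∧ m i₀ = s b := by
    have := (hm i₀).1
    rw [hBdef] at this
    obtain ⟨b, hb, hb'⟩ := Finset.mem_image.1 this
    exact ⟨b, by simpa using hb, hb'.symm⟩
  have hmab : m i₀ = m b := by rw [hmb, hms b hb]
  have H : ∀ y z, m y = m z → y ≠ z → (y = i₀ ∧ z = b) ∨ (y = b ∧ z = i₀) := by
    intro y z hyz hne
    by_cases hy : y = i₀
    · subst hy
      refine Or.inl ⟨rfl, hs ?_⟩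
      rw [← hmb, ← hms z hne.symm, hyz]
    · by_cases hz : z = i₀
      · subst hz
        refine Or.inr ⟨hs ?_, rfl⟩
        rw [← hmb, ← hms y hy, hyz]
      · exact absurd (hs (by rw [← hms y hy, ← hms z hz, hyz])) hne
  obtain ⟨x, hx⟩ : ∃ x, IsReplacement u m i₀ x :=
    exists_isReplacement (y := t) fun j hj => by
      rw [hms j hj]
      exact lt_of_le_of_ne (hmin _ _) fun h => hts ⟨j, hu j h⟩
  have hno : ∀ y, ¬ IsReplacement u m b y := by
    intro y hy
    have h1 := hy.1 i₀ hb.symm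
    rw [hmb] at h1
    by_cases hys : y ∈ Set.range s
    · obtain ⟨l, rfl⟩ := hys
      by_cases hlb : l = b
      · subst hlb; exact lt_irrefl _ h1
      · exact absurd (hy.1 l hlb) (not_lt.2 (hmin _ _))
    · exact lt_asymm h1 (hmax i₀ b y hb hys)
  rw [Set.ncard_eq_one]
  refine ⟨x, ?_⟩
  ext z
  rw [Set.mem_ofPred_eq, Set.mem_singleton_iff,
    isDominant_insert_iff hB hm himg hu hb.symm hmab H]
  constructor
  · rintro (h | h)
    · exact h.unique hu hx
    · exact absurd h (hno z)
  · rintro rfl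
    exact Or.inl hx

theorem isDominant_image_erase [Fintype I] [DecidableEq I] [DecidableEq V] (hmin : ∀ i v, u i (s i) ≤ u i v)
    (hmax : ∀ i j v, j ≠ i → v ∉ Set.range s → u i v < u i (s j)) (i₀ : I) :
    IsDominant u ((Finset.univ.erase i₀).image s) := by
  intro y
  by_cases hy : y ∈ Set.range s
  · obtain ⟨j, rfl⟩ := hy
    exact ⟨j, fun x _ => hmin j x⟩
  · refine ⟨i₀, fun x hx => ?_⟩
    obtain ⟨j, hj, rfl⟩ := Finset.mem_image.1 hx
    exact (hmax i₀ j y (by simpa using hj) hy).le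

/-- **Scarf's lemma**: a colouring in which each slack point `s i` has colour `i` admits a dominant
set that meets every colour. -/
theorem exists_colorful_dominant [Fintype I] [DecidableEq I] [Finite V] [Nontrivial I]
    (hu : ∀ i, Function.Injective (u i)) (hs : Function.Injective s)
    (hmin : ∀ i v, u i (s i) ≤ u i v)
    (hmax : ∀ i j v, j ≠ i → v ∉ Set.range s → u i v < u i (s j))
    {t : V} (hts : t ∉ Set.range s) (c : V → I) (hc : ∀ i, c (s i) = i) :
    ∃ A : Finset V, IsDominant u A ∧ A.image c = Finset.univ := by
  classical
  have := Fintype.ofFinite V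
  by_contra! hcon
  obtain ⟨i₀⟩ := (inferInstance : Nonempty I)
  set C : Finset I := Finset.univ.erase i₀ with hC
  have hCcard : C.card + 1 = Fintype.card I := by
    rw [hC, Finset.card_erase_of_mem (Finset.mem_univ _), Finset.card_univ]
    have := Fintype.card_pos (α := I)
    omega
  -- Doors and rooms show all colours but `i₀`. A room has two doors; a door lies in two rooms,
  -- except the all-slack door, which lies in one. Counting incidences equates an even and an odd
  -- number.
  let doors : Finset (Finset V) := Finset.univ.filter fun B =>
    B.card + 1 = Fintype.card I ∧ IsDominant u B ∧ B.image c = C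
  let rooms : Finset (Finset V) := Finset.univ.filter fun A =>
    A.card = Fintype.card I ∧ IsDominant u A ∧ A.image c = C
  have hdoor : ∀ B, B ∈ doors ↔ B.card + 1 = Fintype.card I ∧ IsDominant u B ∧ B.image c = C :=
    fun B => by simp [doors]
  have hroom : ∀ A, A ∈ rooms ↔ A.card = Fintype.card I ∧ IsDominant u A ∧ A.image c = C :=
    fun A => by simp [rooms]
  have hdc := Finset.sum_card_bipartiteAbove_eq_sum_card_bipartiteBelow
    (s := rooms) (t := doors) (fun A B => B ⊆ A)
  have hleft : ∀ A ∈ rooms, (Finset.bipartiteAbove (fun A B => B ⊆ A) doors A).card = 2 := by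
    intro A hA
    rw [hroom] at hA
    rw [← card_erase_image_eq c A C hA.2.2 (by omega)]
    symm
    refine Finset.card_bij (fun x _ => A.erase x) ?_ ?_ ?_
    · intro x hx
      rw [Finset.mem_filter] at hx
      refine Finset.mem_filter.2 ⟨(hdoor _).2 ⟨?_, ?_, hx.2⟩, Finset.erase_subset _ _⟩
      · rw [Finset.card_erase_add_one hx.1, hA.1]
      · intro y
        obtain ⟨i, hi⟩ := hA.2.1 y
        exact ⟨i, fun w hw => hi w (Finset.mem_of_mem_erase hw)⟩
    · intro x hx y hy hxy
      rw [Finset.mem_filter] at hx hy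
      exact (Finset.erase_inj A hx.1).1 hxy
    · intro B hB
      obtain ⟨hB, hBA⟩ := Finset.mem_filter.1 hB
      rw [hdoor] at hB
      obtain ⟨x, hx⟩ : ∃ x, A \ B = {x} := by
        rw [← Finset.card_eq_one, Finset.card_sdiff_of_subset hBA]
        omega
      have hxA : x ∈ A ∧ x ∉ B := by
        have : x ∈ A \ B := by rw [hx]; simp
        simpa using this
      have hE : A.erase x = B := by
        rw [← Finset.sdiff_singleton_eq_erase, ← hx, Finset.sdiff_sdiff_eq_self hBA]
      exact ⟨x, Finset.mem_filter.2 ⟨hxA.1, by rw [hE]; exact hB.2.2⟩, hE⟩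
  have hcompl : ∀ B ∈ doors, (Finset.bipartiteBelow (fun A B => B ⊆ A) rooms B).card =
      {x | x ∉ B ∧ IsDominant u (insert x B)}.ncard := by
    intro B hB
    rw [hdoor] at hB
    have hset : {x | x ∉ B ∧ IsDominant u (insert x B)} =
        ↑(Finset.univ.filter fun x => x ∉ B ∧ IsDominant u (insert x B)) := by simp
    rw [hset, Set.ncard_coe_finset]
    symm
    refine Finset.card_bij (fun x _ => insert x B) ?_ ?_ ?_
    · intro x hx
      simp only [Finset.mem_filter, Finset.mem_univ, true_and] at hx
      refine Finset.mem_filter.2 ⟨(hroom _).2 ⟨?_, hx.2, ?_⟩, Finset.subset_insert _ _⟩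
      · rw [Finset.card_insert_of_notMem hx.1, hB.1]
      -- A new point of colour `i₀` would complete a colourful dominant set, excluded by `hcon`.
      · have h1 := hcon _ hx.2
        rw [Finset.image_insert, hB.2.2] at h1 ⊢
        refine Finset.insert_eq_of_mem ?_
        by_contra hcx
        apply h1
        have : c x = i₀ := by simpa [hC] using hcx
        rw [this, hC, Finset.insert_erase (Finset.mem_univ _)]
    · intro x hx y hy hxy
      simp only [Finset.mem_filter, Finset.mem_univ, true_and] at hx hy
      exact (Finset.insert_inj hx.1).1 hxy
    · intro A hA
      obtain ⟨hA, hBA⟩ := Finset.mem_filter.1 hA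
      rw [hroom] at hA
      obtain ⟨x, hx⟩ : ∃ x, A \ B = {x} := by
        rw [← Finset.card_eq_one, Finset.card_sdiff_of_subset hBA]
        omega
      have hxA : x ∈ A ∧ x ∉ B := by
        have : x ∈ A \ B := by rw [hx]; simp
        simpa using this
      have hE : insert x B = A := by
        rw [Finset.insert_eq, ← hx, Finset.sdiff_union_of_subset hBA]
      exact ⟨x, by simp [hxA.2, hE, hA.2.1], hE⟩
  have hB₀ : C.image s ∈ doors := by
    refine (hdoor _).2 ⟨?_, isDominant_image_erase hmin hmax i₀, ?_⟩
    · rw [Finset.card_image_of_injective _ hs, hCcard]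
    · rw [Finset.image_image]
      have : c ∘ s = id := funext hc
      rw [this, Finset.image_id]
  rw [Finset.sum_congr rfl hleft, Finset.sum_congr rfl hcompl,
    ← Finset.add_sum_erase _ _ hB₀, card_completions_eq_one hu hs hmin hmax hts i₀
      (isDominant_image_erase hmin hmax i₀)] at hdc
  have hrest : ∀ B ∈ doors.erase (C.image s),
      {x | x ∉ B ∧ IsDominant u (insert x B)}.ncard = 2 := by
    intro B hB
    obtain ⟨hne, hB⟩ := Finset.mem_erase.1 hB
    rw [hdoor] at hB
    have : ∃ t ∈ B, t ∉ Set.range s := by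
      by_contra! hall
      apply hne
      ext x
      rw [← hB.2.2]
      simp only [Finset.mem_image]
      constructor
      · intro hx
        obtain ⟨i, rfl⟩ := hall x hx
        exact ⟨i, ⟨s i, hx, hc i⟩, rfl⟩
      · rintro ⟨i, ⟨y, hy, rfl⟩, rfl⟩
        obtain ⟨j, rfl⟩ := hall y hy
        rwa [hc]
    obtain ⟨t, ht, hts⟩ := this
    exact card_completions_eq_two hB.2.1 hu hs hmin hmax hB.1 ht hts
  rw [Finset.sum_congr rfl hrest] at hdc
  simp only [Finset.sum_const, smul_eq_mul] at hdc
  omega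

end Door

end Scarf

/-! ### Brouwer's theorem on a simplex. -/

section Brouwer

variable {I : Type*} [Fintype I]

/-- The points of the simplex with coordinates in `ℕ / N`, scaled by `N`. -/
abbrev GridPoint (I : Type*) [Fintype I] [DecidableEq I] (N : ℕ) : Type _ :=
  Finset.piAntidiag (Finset.univ : Finset I) N

/-- A colouring of the grid points of a simplex has a point that is, for each colour `i`, either
near a point of colour `i` or near the face on which the coordinate `i` vanishes. -/
theorem exists_grid_point_near_colors [Nontrivial I] [DecidableEq I] (N : ℕ)
    (c : GridPoint I N → I) :
    ∃ x : GridPoint I N, ∀ i,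
      (∃ y, c y = i ∧ ∀ k, y.1 k ≤ x.1 k + Fintype.card I ∧ x.1 k ≤ y.1 k + Fintype.card I) ∨
        x.1 i ≤ Fintype.card I := by
  classical
  let T := GridPoint I N
  have hsum : ∀ x : T, ∑ i, x.1 i = N := fun x => (Finset.mem_piAntidiag.1 x.2).1
  let K : ℤ := Fintype.card (T ⊕ I)
  let e : T ⊕ I ≃ Fin (Fintype.card (T ⊕ I)) := Fintype.equivFin _
  -- Grid values lie in `[1, N + 1]`; the slack point `j` is below them in coordinate `j` and above
  -- them elsewhere. Since `e v < K`, scaling by `K` lets `e` break ties only.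
  let b : I → T ⊕ I → ℤ := fun i => Sum.elim (fun x => (x.1 i : ℤ) + 1)
    fun j => if j = i then 0 else N + 2
  let u : I → T ⊕ I → ℤ := fun i v => b i v * K + (e v : ℕ)
  have he : ∀ v, (0 : ℤ) ≤ ((e v : ℕ) : ℤ) ∧ ((e v : ℕ) : ℤ) < K := fun v =>
    ⟨by positivity, by simp only [K]; exact_mod_cast (e v).2⟩
  have hlt : ∀ i v w, b i v < b i w → u i v < u i w := by
    intro i v w h
    have h1 := he v
    have h2 := he w
    simp only [u]
    nlinarith
  have hle : ∀ i v w, u i v ≤ u i w → b i v ≤ b i w := by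
    intro i v w h
    by_contra! h'
    exact absurd (hlt i w v h') (not_lt.2 h)
  have hu : ∀ i, Function.Injective (u i) := by
    intro i v w h
    have hb : b i v = b i w := le_antisymm (hle i _ _ h.le) (hle i _ _ h.ge)
    simp only [u, hb] at h
    apply e.injective
    apply Fin.ext
    omega
  have hxN : ∀ (x : T) i, x.1 i ≤ N := fun x i => by
    refine le_of_le_of_eq ?_ (hsum x); exact Finset.single_le_sum (fun _ _ => Nat.zero_le _) (Finset.mem_univ i)
  have hbx : ∀ i (x : T), b i (Sum.inl x) = (x.1 i : ℤ) + 1 := fun _ _ => rfl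
  have hbs : ∀ i, b i (Sum.inr i) = 0 := fun i => by simp [b]
  have hbs' : ∀ i j, j ≠ i → b i (Sum.inr j) = N + 2 := fun i j h => by simp [b, h]
  have hs : Function.Injective (Sum.inr : I → T ⊕ I) := Sum.inr_injective
  have hmin : ∀ i v, u i (Sum.inr i) ≤ u i v := by
    intro i v
    by_cases hv : v = Sum.inr i
    · rw [hv]
    refine (hlt i _ _ ?_).le
    rw [hbs]
    rcases v with x | j
    · rw [hbx]; positivity
    · rw [hbs' i j (fun h => hv (by rw [h]))]; positivity
  have hmax : ∀ i j v, j ≠ i → v ∉ Set.range (Sum.inr : I → T ⊕ I) →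
      u i v < u i (Sum.inr j) := by
    intro i j v hji hv
    rcases v with x | l
    · refine hlt i _ _ ?_
      rw [hbx, hbs' i j hji]
      have := hxN x i
      omega
    · exact absurd ⟨l, rfl⟩ hv
  obtain ⟨i₁⟩ := (inferInstance : Nonempty I)
  let t : T := ⟨Pi.single i₁ N, by
    rw [Finset.mem_piAntidiag]
    exact ⟨by simp, fun i _ => Finset.mem_univ i⟩⟩
  obtain ⟨A, hA, hcol⟩ := Scarf.exists_colorful_dominant hu hs hmin hmax (t := Sum.inl t)
    (by simp) (Sum.elim c id) (fun i => rfl)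
  have hdom : ∀ y : T, ∃ i, Sum.inr i ∉ A ∧ ∀ x : T, Sum.inl x ∈ A → y.1 i ≤ x.1 i := by
    intro y
    obtain ⟨i, hi⟩ := hA (Sum.inl y)
    refine ⟨i, fun h => ?_, fun x hx => ?_⟩
    · have := hle _ _ _ (hi _ h)
      rw [hbx, hbs] at this
      omega
    · have := hle _ _ _ (hi _ hx)
      rw [hbx, hbx] at this
      omega
  have hcolor : ∀ i, Sum.inr i ∉ A → ∃ x : T, Sum.inl x ∈ A ∧ c x = i := by
    intro i hi
    have : i ∈ A.image (Sum.elim c id) := by rw [hcol]; simp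
    obtain ⟨v, hv, hvi⟩ := Finset.mem_image.1 this
    rcases v with x | j
    · exact ⟨x, hv, hvi⟩
    · have : j = i := hvi
      exact absurd (this ▸ hv) hi
  obtain ⟨i₂, hi₂, -⟩ := hdom t
  obtain ⟨x₀, hx₀, -⟩ := hcolor i₂ hi₂
  have : ∀ i, ∃ z : T, Sum.inl z ∈ A ∧ ∀ x : T, Sum.inl x ∈ A → z.1 i ≤ x.1 i := by
    intro i
    obtain ⟨z, hz, hz'⟩ := (Finset.univ.filter fun x : T => Sum.inl x ∈ A).exists_min_image
      (fun x => x.1 i) ⟨x₀, by simpa using hx₀⟩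
    exact ⟨z, by simpa using hz, fun x hx => hz' x (by simpa using hx)⟩
  choose z hzA hz using this
  let C : Finset I := Finset.univ.filter fun i => Sum.inr i ∉ A
  have hC : ∀ i, i ∈ C ↔ Sum.inr i ∉ A := fun i => by simp [C]
  -- Otherwise some grid point exceeds the minimum over `A` in every coordinate of `C` (the surplus
  -- goes to `i₂`), against dominance. So the minima over `C` nearly exhaust `N`, and the grid
  -- points of `A` are close together.
  have hlarge : N < ∑ i ∈ C, ((z i).1 i + 1) := by
    by_contra! hcon
    let y : I → ℕ := fun i => (if i ∈ C then (z i).1 i + 1 else 0) +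
      if i = i₂ then N - ∑ i ∈ C, ((z i).1 i + 1) else 0
    have hy : ∑ i, y i = N := by
      simp only [y, Finset.sum_add_distrib, Finset.sum_ite_eq', Finset.mem_univ, if_true,
        Finset.sum_ite_mem, Finset.univ_inter] at hcon ⊢
      omega
    obtain ⟨i, hi, hi'⟩ := hdom ⟨y, Finset.mem_piAntidiag.2 ⟨hy, fun i _ => Finset.mem_univ i⟩⟩
    have h1 := hi' _ (hzA i)
    have h2 : (z i).1 i + 1 ≤ y i := by
      simp only [y, if_pos ((hC i).2 hi)]
      omega
    simp only at h1
    omega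
  have hCn : C.card ≤ Fintype.card I := Finset.card_le_univ _
  rw [Finset.sum_add_distrib, Finset.sum_const, smul_eq_mul, mul_one] at hlarge
  have hsplit : ∀ x : T, ∑ i ∈ C, x.1 i + ∑ i ∈ Cᶜ, x.1 i = N := fun x => by
    rw [Finset.sum_add_sum_compl, hsum]
  have hin : ∀ x : T, Sum.inl x ∈ A → ∀ i ∈ C, x.1 i ≤ (z i).1 i + Fintype.card I := by
    intro x hx i hi
    have h1 := hsplit x
    have h2 := Finset.add_sum_erase C (fun i => x.1 i) hi
    have h3 := Finset.add_sum_erase C (fun i => (z i).1 i) hi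
    have h4 : ∑ i ∈ C.erase i, (z i).1 i ≤ ∑ i ∈ C.erase i, x.1 i :=
      Finset.sum_le_sum fun j _ => hz j x hx
    omega
  have hout : ∀ x : T, Sum.inl x ∈ A → ∀ i, i ∉ C → x.1 i ≤ Fintype.card I := by
    intro x hx i hi
    have h1 := hsplit x
    have h2 : x.1 i ≤ ∑ i ∈ Cᶜ, x.1 i :=
      Finset.single_le_sum (f := fun i => x.1 i) (fun _ _ => Nat.zero_le _) (by simpa using hi)
    have h4 : ∑ i ∈ C, (z i).1 i ≤ ∑ i ∈ C, x.1 i :=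
      Finset.sum_le_sum fun j _ => hz j x hx
    omega
  refine ⟨x₀, fun i => ?_⟩
  by_cases hi : i ∈ C
  · left
    obtain ⟨y, hy, hyi⟩ := hcolor i ((hC i).1 hi)
    refine ⟨y, hyi, fun k => ?_⟩
    by_cases hk : k ∈ C
    · have := hin y hy k hk
      have := hin x₀ hx₀ k hk
      have := hz k y hy
      have := hz k x₀ hx₀
      omega
    · have := hout y hy k hk
      have := hout x₀ hx₀ k hk
      omega
  · exact Or.inr (hout x₀ hx₀ i hi)

/-- Colour a grid point by a coordinate that `f` does not decrease; one exists since both sums are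
1. No boundary condition is needed: a coordinate without a nearby point of its colour is itself
small. -/
theorem exists_approx_fixedPoint_stdSimplex [Nontrivial I] {f : (I → ℝ) → I → ℝ}
    (hf : ContinuousOn f (stdSimplex ℝ I)) (hmaps : Set.MapsTo f (stdSimplex ℝ I) (stdSimplex ℝ I))
    {η : ℝ} (hη : 0 < η) : ∃ x ∈ stdSimplex ℝ I, ∀ i, x i ≤ f x i + η := by
  classical
  have huc := (isCompact_stdSimplex ℝ I).uniformContinuousOn_of_continuous hf
  obtain ⟨d, hd, hfd⟩ := Metric.uniformContinuousOn_iff.1 huc (η / 2) (by positivity)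
  obtain ⟨n, hncard⟩ : ∃ n : ℝ, n = Fintype.card I := ⟨_, rfl⟩
  -- The grid distance `n / N` is below `d`, so `f` varies by less than `η / 2`, and below `η / 2`
  -- itself.
  obtain ⟨N, hN⟩ := exists_nat_gt (n / min d (η / 2))
  have hn : 0 < n := by rw [hncard]; exact_mod_cast Fintype.card_pos
  have hm : 0 < min d (η / 2) := by positivity
  have hN0 : (0 : ℝ) < N := lt_trans (by positivity) hN
  have hnN : n / N < min d (η / 2) := by
    rw [div_lt_iff₀ hm] at hN
    rw [div_lt_iff₀ hN0]
    linarith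
  have hnd := hnN.trans_le (min_le_left _ _)
  have hnη := hnN.trans_le (min_le_right _ _)
  let p : GridPoint I N → I → ℝ := fun x i => x.1 i / N
  have hp : ∀ x, p x ∈ stdSimplex ℝ I := by
    intro x
    refine ⟨fun i => by positivity, ?_⟩
    have := (Finset.mem_piAntidiag.1 x.2).1
    simp only [p]
    rw [← Finset.sum_div, ← Nat.cast_sum, this, div_self hN0.ne']
  have hc : ∀ x, ∃ i, p x i ≤ f (p x) i := by
    intro x
    by_contra! hcon
    have := Finset.sum_lt_sum_of_nonempty Finset.univ_nonempty fun i _ => hcon i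
    rw [(hp x).2, (hmaps (hp x)).2] at this
    exact lt_irrefl _ this
  choose c hc using hc
  obtain ⟨x, hx⟩ := exists_grid_point_near_colors N c
  refine ⟨p x, hp x, fun i => ?_⟩
  rcases hx i with ⟨y, rfl, hy⟩ | hxi
  · have hdist : ∀ k, |p x k - p y k| ≤ n / N := by
      intro k
      have h1 : ((y.1 k : ℕ) : ℝ) ≤ x.1 k + n := by rw [hncard]; exact_mod_cast (hy k).1
      have h2 : ((x.1 k : ℕ) : ℝ) ≤ y.1 k + n := by rw [hncard]; exact_mod_cast (hy k).2
      simp only [p]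
      rw [← sub_div, abs_div, abs_of_pos hN0]
      gcongr
      rw [abs_le]
      constructor <;> linarith
    have hxy : dist (p x) (p y) < d := by
      refine lt_of_le_of_lt ((dist_pi_le_iff (by positivity)).2 fun k => ?_) hnd
      rw [Real.dist_eq]
      exact hdist k
    have h1 := (dist_le_pi_dist (f (p x)) (f (p y)) (c y)).trans_lt (hfd _ (hp x) _ (hp y) hxy)
    rw [Real.dist_eq] at h1
    have h2 := abs_lt.1 h1
    have h3 := abs_le.1 (hdist (c y))
    have h4 := hc y
    linarith
  · have h1 : p x i ≤ n / N := by
      simp only [p]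
      gcongr
      rw [hncard]
      exact_mod_cast hxi
    have h2 := (hmaps (hp x)).1 i
    linarith

/-- **Brouwer's fixed-point theorem** for the standard simplex. -/
theorem exists_fixedPoint_stdSimplex [Nonempty I] {f : (I → ℝ) → I → ℝ}
    (hf : ContinuousOn f (stdSimplex ℝ I))
    (hmaps : Set.MapsTo f (stdSimplex ℝ I) (stdSimplex ℝ I)) :
    ∃ x ∈ stdSimplex ℝ I, f x = x := by
  classical
  rcases subsingleton_or_nontrivial I with hI | hI
  · obtain ⟨i₀⟩ := (inferInstance : Nonempty I)
    have key : ∀ x ∈ stdSimplex ℝ I, x = fun _ => 1 := by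
      intro x hx
      have := hx.2
      have hu : (Finset.univ : Finset I) = {i₀} := by
        ext i; simp [Subsingleton.elim i i₀]
      rw [hu, Finset.sum_singleton] at this
      ext i
      rw [Subsingleton.elim i i₀, this]
    have hx := single_mem_stdSimplex ℝ i₀
    exact ⟨_, hx, by rw [key _ (hmaps hx), ← key _ hx]⟩
  -- Approximate fixed points force the minimum of the total excess to be 0; then `x ≤ f x` with
  -- equal sums gives equality.
  let g : (I → ℝ) → ℝ := fun x => ∑ i, max 0 (x i - f x i)
  have hg : ContinuousOn g (stdSimplex ℝ I) := by
    refine continuousOn_finsetSum _ fun i _ => ?_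
    refine continuousOn_const.sup (ContinuousOn.sub (by fun_prop) ?_)
    exact (continuous_apply i).comp_continuousOn hf
  obtain ⟨i₀⟩ := (inferInstance : Nonempty I)
  obtain ⟨x, hx, hmin⟩ := (isCompact_stdSimplex ℝ I).exists_isMinOn
    ⟨_, single_mem_stdSimplex ℝ i₀⟩ hg
  have hn : (0 : ℝ) < Fintype.card I := by exact_mod_cast Fintype.card_pos
  have hg0 : g x ≤ 0 := by
    refine le_of_forall_pos_le_add fun η hη => ?_
    obtain ⟨y, hy, hy'⟩ := exists_approx_fixedPoint_stdSimplex hf hmaps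
      (η := η / Fintype.card I) (by positivity)
    calc g x ≤ g y := hmin hy
      _ ≤ ∑ _i : I, η / Fintype.card I := by
        refine Finset.sum_le_sum fun i _ => max_le (by positivity) ?_
        linarith [hy' i]
      _ = 0 + η := by
        rw [Finset.sum_const, Finset.card_univ, nsmul_eq_mul]
        field_simp
        ring
  have hle : ∀ i, x i ≤ f x i := by
    intro i
    have h1 : max 0 (x i - f x i) ≤ g x :=
      Finset.single_le_sum (f := fun i => max 0 (x i - f x i)) (fun _ _ => le_max_left _ _)
        (Finset.mem_univ i)
    have h2 := le_max_right 0 (x i - f x i)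
    linarith
  refine ⟨x, hx, ?_⟩
  have := (Finset.sum_eq_sum_iff_of_le fun i _ => hle i).1
    (by rw [hx.2, (hmaps hx).2])
  ext i
  exact (this i (Finset.mem_univ i)).symm

end Brouwer

/-! ### Products of simplices and Nash's theorem. -/

section Equilibrium

/-- **Brouwer's fixed-point theorem** for a continuous self-map of the standard simplex. -/
theorem exists_fixedPoint_of_continuous_stdSimplex {I : Type*} [Fintype I] [Nonempty I]
    {f : stdSimplex ℝ I → stdSimplex ℝ I} (hf : Continuous f) : ∃ x, f x = x := by
  classical
  let F : (I → ℝ) → I → ℝ := fun x => if h : x ∈ stdSimplex ℝ I then f ⟨x, h⟩ else x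
  have hF : ∀ x : stdSimplex ℝ I, F x = f x := fun x => dif_pos x.2
  obtain ⟨x, hx, hfx⟩ := exists_fixedPoint_stdSimplex (f := F)
    (by
      rw [continuousOn_iff_continuous_domRestrict]
      exact (continuous_subtype_val.comp hf).congr fun x => (hF x).symm)
    (fun x hx => by
      have h : F x = f ⟨x, hx⟩ := hF ⟨x, hx⟩
      rw [h]
      exact (f ⟨x, hx⟩).2)
  exact ⟨⟨x, hx⟩, Subtype.ext ((hF ⟨x, hx⟩).symm.trans hfx)⟩

variable {S : Type*} {κ : S → Type*} [∀ s, Fintype (κ s)]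

variable (κ) in
/-- The product of the standard simplices on the types `κ s`. -/
def simplexProduct : Set (∀ s, κ s → ℝ) :=
  {p | ∀ s, p s ∈ stdSimplex ℝ (κ s)}

theorem continuous_coord (s : S) (x : κ s) : Continuous fun p : simplexProduct κ => p.1 s x :=
  (continuous_apply x).comp ((continuous_apply s).comp continuous_subtype_val)

variable [Fintype S] [Nonempty S] [∀ s, Nonempty (κ s)]

/-- **Brouwer's fixed-point theorem** for products of standard simplices. -/
theorem exists_fixedPoint_simplexProduct {f : simplexProduct κ → simplexProduct κ}
    (hf : Continuous f) : ∃ p, f p = p := by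
  let n : ℝ := Fintype.card S
  have hn : 0 < n := by simp only [n]; exact_mod_cast Fintype.card_pos
  let U : ((Σ s, κ s) → ℝ) → S → ℝ := fun w s => ∑ x, n * w ⟨s, x⟩
  -- Blocks of `n * w` with mass above 1 are scaled down, those below 1 are filled up uniformly. The
  -- result is a continuous left inverse of the embedding `j`.
  let r : stdSimplex ℝ (Σ s, κ s) → simplexProduct κ := fun w =>
    ⟨fun s x => (n * w.1 ⟨s, x⟩ + max 0 (1 - U w.1 s) / Fintype.card (κ s)) / max 1 (U w.1 s), by
      intro s
      have hpos : 0 < max 1 (U w.1 s) := lt_max_of_lt_left one_pos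
      refine ⟨fun x => ?_, ?_⟩
      · have := w.2.1 ⟨s, x⟩
        positivity
      · have hc : (Fintype.card (κ s) : ℝ) ≠ 0 := by exact_mod_cast Fintype.card_ne_zero
        rw [← Finset.sum_div, Finset.sum_add_distrib, Finset.sum_const, Finset.card_univ,
          nsmul_eq_mul, mul_div_cancel₀ _ hc, div_eq_one_iff_eq hpos.ne']
        change U w.1 s + _ = _
        rcases le_total (U w.1 s) 1 with h | h
        · rw [max_eq_right (by linarith), max_eq_left h]; ring
        · rw [max_eq_left (by linarith), max_eq_right h]; ring⟩
  let j : simplexProduct κ → stdSimplex ℝ (Σ s, κ s) := fun p =>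
    ⟨fun i => p.1 i.1 i.2 / n, by
      refine ⟨fun i => div_nonneg ((p.2 i.1).1 i.2) hn.le, ?_⟩
      rw [← Finset.sum_div, Fintype.sum_sigma, Finset.sum_congr rfl fun s _ => (p.2 s).2,
        Finset.sum_const, Finset.card_univ, nsmul_eq_mul, mul_one, div_self hn.ne']⟩
  have hrj : ∀ p, r (j p) = p := by
    intro p
    apply Subtype.ext
    funext s x
    have hU : U (j p).1 s = 1 := by
      rw [← (p.2 s).2]
      exact Finset.sum_congr rfl fun x _ => mul_div_cancel₀ _ hn.ne'
    simp only [r, hU]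
    simp only [j, mul_div_cancel₀ _ hn.ne']
    simp
  have hrc : Continuous r := by
    refine Continuous.subtype_mk (continuous_pi fun s => continuous_pi fun x => ?_) _
    have hw : ∀ i, Continuous fun w : stdSimplex ℝ (Σ s, κ s) => n * w.1 i := fun i =>
      continuous_const.mul ((continuous_apply i).comp continuous_subtype_val)
    have hU : Continuous fun w : stdSimplex ℝ (Σ s, κ s) => U w.1 s :=
      continuous_finsetSum _ fun x _ => hw _
    exact Continuous.div ((hw _).add ((continuous_const.max (continuous_const.sub hU)).div_const _))
      (continuous_const.max hU) fun w => (lt_max_of_lt_left one_pos).ne'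
  have hjc : Continuous j := by
    exact Continuous.subtype_mk (continuous_pi fun i : (Σ s, κ s) => (continuous_coord i.1 i.2).div_const _) _
  obtain ⟨s₀⟩ := (inferInstance : Nonempty S)
  obtain ⟨x₀⟩ := (inferInstance : Nonempty (κ s₀))
  have : Nonempty (Σ s, κ s) := ⟨⟨s₀, x₀⟩⟩
  obtain ⟨w, hw⟩ := exists_fixedPoint_of_continuous_stdSimplex (f := j ∘ f ∘ r)
    (hjc.comp (hf.comp hrc))
  refine ⟨f (r w), ?_⟩
  conv_rhs => rw [← hw]
  simp only [Function.comp_apply, hrj]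

/-- **Nash's theorem** for payoffs that depend continuously on the profile: some profile of mixed
actions is, for each `s`, at least as good as every pure action. -/
theorem exists_nash_simplexProduct {A : simplexProduct κ → ∀ s, κ s → ℝ} (hA : Continuous A) :
    ∃ p, ∀ s y, A p s y ≤ ∑ x, p.1 s x * A p s x := by
  let g : simplexProduct κ → ∀ s, κ s → ℝ := fun p s x =>
    max 0 (A p s x - ∑ x, p.1 s x * A p s x)
  have hg0 : ∀ p s x, 0 ≤ g p s x := fun p s x => le_max_left _ _
  have hG0 : ∀ p s, 0 < 1 + ∑ x, g p s x := fun p s =>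
    add_pos_of_pos_of_nonneg one_pos (Finset.sum_nonneg fun x _ => hg0 p s x)
  have hgc : ∀ s x, Continuous fun p => g p s x := by
    intro s x
    have hAc : ∀ x, Continuous fun p => A p s x := fun x =>
      (continuous_apply x).comp ((continuous_apply s).comp hA)
    exact continuous_const.max ((hAc x).sub
      (continuous_finsetSum _ fun x _ => (continuous_coord s x).mul (hAc x)))
  let f : simplexProduct κ → simplexProduct κ := fun p =>
    ⟨fun s x => (p.1 s x + g p s x) / (1 + ∑ x, g p s x), fun s =>
      ⟨fun x => div_nonneg (add_nonneg ((p.2 s).1 x) (hg0 p s x)) (hG0 p s).le, by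
        rw [← Finset.sum_div, Finset.sum_add_distrib, (p.2 s).2, div_self (hG0 p s).ne']⟩⟩
  have hf : Continuous f := by
    refine Continuous.subtype_mk (continuous_pi fun s => continuous_pi fun x => ?_) _
    refine Continuous.div ?_ ?_ fun p => (hG0 p s).ne'
    · exact (continuous_coord s x).add (hgc s x)
    · exact continuous_const.add (continuous_finsetSum _ fun x _ => hgc s x)
  obtain ⟨p, hp⟩ := exists_fixedPoint_simplexProduct hf
  refine ⟨p, fun s y => ?_⟩
  -- At a fixed point of the Nash map the gains are proportional to the weights, and the weighted
  -- mean of `A - a` is 0. So `∑ g * (A - a) = ∑ g ^ 2` vanishes.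
  have h1 : ∀ x, p.1 s x * ∑ x, g p s x = g p s x := by
    intro x
    have h := congrFun (congrFun (congrArg Subtype.val hp) s) x
    simp only [f] at h
    rw [div_eq_iff (hG0 p s).ne'] at h
    linarith
  set a := ∑ x, p.1 s x * A p s x with ha
  have h2 : ∑ x, g p s x * (A p s x - a) = 0 := by
    calc ∑ x, g p s x * (A p s x - a)
        = ∑ x, (p.1 s x * A p s x * ∑ x, g p s x) - ∑ x, p.1 s x * (a * ∑ x, g p s x) := by
          rw [← Finset.sum_sub_distrib]
          refine Finset.sum_congr rfl fun x _ => ?_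
          rw [← h1 x]
          ring
      _ = 0 := by rw [← Finset.sum_mul, ← Finset.sum_mul, (p.2 s).2, ← ha]; ring
  have h3 : ∀ x, g p s x * (A p s x - a) = g p s x ^ 2 := by
    intro x
    simp only [g]
    rw [← ha]
    rcases le_total (A p s x - a) 0 with h | h
    · rw [max_eq_left h]; ring
    · rw [max_eq_right h]; ring
  rw [Finset.sum_congr rfl fun x _ => h3 x] at h2
  have h4 := (Finset.sum_eq_zero_iff_of_nonneg fun x _ => sq_nonneg (g p s x)).1 h2 y
    (Finset.mem_univ y)
  have h5 : g p s y = 0 := by simpa using h4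
  have h6 := le_max_right 0 (A p s y - a)
  have h7 : max 0 (A p s y - a) = 0 := h5
  linarith

end Equilibrium

/-- A function that can be read off from any point related to its argument by a closed relation
with values in a compact space is continuous. -/
theorem continuous_of_isClosed_relation {A Y Z : Type*} [TopologicalSpace A] [TopologicalSpace Y]
    [TopologicalSpace Z] [CompactSpace Y] {G : Set (A × Y)} (hG : IsClosed G) {g : Y → Z}
    (hg : Continuous g) {h : A → Z} (hex : ∀ a, ∃ y, (a, y) ∈ G)
    (huniq : ∀ a y, (a, y) ∈ G → g y = h a) : Continuous h := by
  rw [continuous_iff_isClosed]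
  intro F hF
  -- Projection along a compact factor is a closed map.
  have : h ⁻¹' F = Prod.fst '' (G ∩ (fun q : A × Y => g q.2) ⁻¹' F) := by
    ext a
    constructor
    · intro ha
      obtain ⟨y, hy⟩ := hex a
      refine ⟨(a, y), ⟨hy, ?_⟩, rfl⟩
      change g y ∈ F
      rw [huniq a y hy]
      exact ha
    · rintro ⟨⟨a', y⟩, ⟨hy, hyF⟩, rfl⟩
      change h a' ∈ F
      rw [← huniq a' y hy]
      exact hyF
  rw [this]
  exact isClosedMap_fst_of_compactSpace _ (hG.inter (hF.preimage (hg.comp continuous_snd)))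

/-! ### Stationary distributions under full communication. -/

namespace MDP

variable {S X : Type*} [Fintype S] [Fintype X] (M : MDP S X)

theorem sum_Gr [DecidableEq X] (g : Gr M.Γ → ℝ) :
    ∑ z, g z = ∑ s, ∑ x : {x // x ∈ M.Γ s}, g ⟨(s, x), x.2⟩ := by
  rw [← Fintype.sum_sigma' (f := fun s (x : {x // x ∈ M.Γ s}) => g ⟨(s, x), x.2⟩)]
  refine Fintype.sum_equiv
    { toFun := fun z => ⟨z.1.1, z.1.2, z.2⟩
      invFun := fun i => ⟨(i.1, i.2), i.2.2⟩
      left_inv := fun _ => rfl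
      right_inv := fun _ => rfl } _ _ fun z => rfl

variable {M}

theorem sum_strategy {σ : S → X → ℝ} (hσ : σ ∈ M.strategies) (s : S) :
    ∑ x : {x // x ∈ M.Γ s}, σ s x = 1 := by
  rw [Finset.sum_coe_sort (M.Γ s) (σ s), ← (hσ s).1.2]
  exact Finset.sum_subset (Finset.subset_univ _) fun x _ hx => (hσ s).2 x hx

theorem sum_kernel [DecidableEq X] {σ : S → X → ℝ} (hσ : σ ∈ M.strategies) (z : Gr M.Γ) :
    ∑ z', M.kernel σ z' z = 1 := by
  rw [sum_Gr, ← (M.Q_mem z).2]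
  refine Finset.sum_congr rfl fun s _ => ?_
  simp only [kernel]
  rw [← Finset.sum_mul, sum_strategy hσ, one_mul]

theorem kernel_nonneg {σ : S → X → ℝ} (hσ : σ ∈ M.strategies) (z' z : Gr M.Γ) :
    0 ≤ M.kernel σ z' z :=
  mul_nonneg ((hσ _).1.1 _) ((M.Q_mem z).1 _)

theorem exists_isStationary [DecidableEq X] [Nonempty S] {σ : S → X → ℝ} (hσ : σ ∈ M.strategies) :
    ∃ m, M.IsStationary σ m := by
  obtain ⟨s⟩ := (inferInstance : Nonempty S)
  obtain ⟨x, hx⟩ := M.Γ_nonempty s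
  have : Nonempty (Gr M.Γ) := ⟨⟨(s, x), hx⟩⟩
  let f : stdSimplex ℝ (Gr M.Γ) → stdSimplex ℝ (Gr M.Γ) := fun m =>
    ⟨fun z' => ∑ z, M.kernel σ z' z * m.1 z, fun z' =>
      Finset.sum_nonneg fun z _ => mul_nonneg (kernel_nonneg hσ z' z) (m.2.1 z), by
      rw [Finset.sum_comm, ← m.2.2]
      refine Finset.sum_congr rfl fun z _ => ?_
      rw [← Finset.sum_mul, sum_kernel hσ, one_mul]⟩
  obtain ⟨m, hm⟩ := exists_fixedPoint_of_continuous_stdSimplex (f := f)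
    (Continuous.subtype_mk (continuous_pi fun z' => continuous_finsetSum _ fun z _ =>
      continuous_const.mul ((continuous_apply z).comp continuous_subtype_val)) _)
  exact ⟨m.1, m.2, fun z' => (congrFun (congrArg Subtype.val hm) z').symm⟩

/-- A nonnegative invariant vector of a strategy with full support vanishes nowhere or
everywhere. -/
theorem FullCommunication.pos_of_invariant [DecidableEq X] (hfull : M.FullCommunication) {σ : S → X → ℝ}
    (hσ : ∀ s, ∀ x ∈ M.Γ s, 0 < σ s x) {m : Gr M.Γ → ℝ} (hm : ∀ z, 0 ≤ m z)
    (hinv : ∀ z', m z' = ∑ z, M.kernel σ z' z * m z) {z₀ : Gr M.Γ} (hz₀ : 0 < m z₀)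
    (z : Gr M.Γ) : 0 < m z := by
  have hfac : ∀ z', m z' = σ z'.1.1 z'.1.2 * ∑ z, M.Q z z'.1.1 * m z := by
    intro z'
    rw [hinv z', Finset.mul_sum]
    exact Finset.sum_congr rfl fun z _ => by rw [kernel, mul_assoc]
  -- Needed because the communicating path may leave the state of `z₀` by another action.
  have hsame : ∀ z z' : Gr M.Γ, z'.1.1 = z.1.1 → 0 < m z → 0 < m z' := by
    intro z z' h hz
    rw [hfac z] at hz
    rw [hfac z', h]
    refine mul_pos (h ▸ hσ _ _ z'.2) ?_
    exact pos_of_mul_pos_right hz (hσ _ _ z.2).le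
  have hstep : ∀ z z' : Gr M.Γ, 0 < M.Q z z'.1.1 → 0 < m z → 0 < m z' := by
    intro z z' h hz
    rw [hfac z']
    refine mul_pos (hσ _ _ z'.2) ?_
    exact Finset.sum_pos' (fun w _ => mul_nonneg ((M.Q_mem w).1 _) (hm w))
      ⟨z, Finset.mem_univ z, mul_pos h hz⟩
  obtain ⟨n, w, hw0, hw⟩ := hfull z₀.1.1 z.1.1
  have hprod0 : 0 ≤ ∏ i : Fin n, M.Q (w i.castSucc) (w i.succ).1.1 :=
    Finset.prod_nonneg fun i _ => (M.Q_mem _).1 _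
  have hlast : 0 < M.Q (w (Fin.last n)) z.1.1 := pos_of_mul_pos_left hw hprod0
  have hprod : 0 < ∏ i : Fin n, M.Q (w i.castSucc) (w i.succ).1.1 :=
    pos_of_mul_pos_right hw hlast.le
  have hi : ∀ i : Fin n, 0 < M.Q (w i.castSucc) (w i.succ).1.1 := fun i =>
    lt_of_le_of_ne ((M.Q_mem _).1 _)
      (Finset.prod_ne_zero_iff.1 hprod.ne' i (Finset.mem_univ i)).symm
  have hall : ∀ i, 0 < m (w i) := by
    intro i
    induction i using Fin.induction with
    | zero => exact hsame z₀ _ hw0 hz₀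
    | succ i ih => exact hstep _ _ (hi i) ih
  exact hstep _ _ hlast (hall _)

theorem IsStationary.pos [DecidableEq X] (hfull : M.FullCommunication) {σ : S → X → ℝ}
    (hσ : ∀ s, ∀ x ∈ M.Γ s, 0 < σ s x) {m : Gr M.Γ → ℝ} (hm : M.IsStationary σ m)
    (z : Gr M.Γ) : 0 < m z := by
  obtain ⟨z₀, -, hz₀⟩ : ∃ z₀ ∈ Finset.univ, 0 < m z₀ := by
    refine Finset.exists_lt_of_sum_lt ?_
    rw [hm.1.2]
    simp
  exact hfull.pos_of_invariant hσ hm.1.1 hm.2 hz₀ z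

/-- Subtracting from `m` the largest multiple of `m'` that keeps it nonnegative leaves an invariant
vector with a zero, hence the zero vector; total mass makes the multiple 1. -/
theorem IsStationary.unique [DecidableEq X] (hfull : M.FullCommunication) {σ : S → X → ℝ}
    (hσ : ∀ s, ∀ x ∈ M.Γ s, 0 < σ s x) {m m' : Gr M.Γ → ℝ} (hm : M.IsStationary σ m)
    (hm' : M.IsStationary σ m') : m = m' := by
  have hpos := hm'.pos hfull hσ
  have hne : (Finset.univ : Finset (Gr M.Γ)).Nonempty := by
    by_contra h
    have := hm.1.2
    rw [Finset.not_nonempty_iff_eq_empty.1 h] at this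
    simp at this
  obtain ⟨z₀, -, hz₀⟩ := Finset.exists_min_image Finset.univ (fun z => m z / m' z) hne
  set t := m z₀ / m' z₀ with ht
  have hnn : ∀ z, 0 ≤ m z - t * m' z := by
    intro z
    have := (le_div_iff₀ (hpos z)).1 (hz₀ z (Finset.mem_univ z))
    linarith
  have hinv : ∀ z', m z' - t * m' z' = ∑ z, M.kernel σ z' z * (m z - t * m' z) := by
    intro z'
    rw [hm.2 z', hm'.2 z', Finset.mul_sum, ← Finset.sum_sub_distrib]
    exact Finset.sum_congr rfl fun z _ => by ring
  have hzero : ∀ z, m z = t * m' z := by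
    intro z
    by_contra hz
    have h1 : 0 < m z - t * m' z := lt_of_le_of_ne (hnn z) fun h => hz (by linarith)
    have h2 := hfull.pos_of_invariant hσ hnn hinv h1 z₀
    rw [ht, div_mul_cancel₀ _ (hpos z₀).ne'] at h2
    linarith
  have h1 : t = 1 := by
    have := hm.1.2
    rw [Finset.sum_congr rfl fun z _ => hzero z, ← Finset.mul_sum, hm'.1.2, mul_one] at this
    exact this
  funext z
  rw [hzero z, h1, one_mul]

/-- The stationary distribution depends continuously on the perturbed strategy. -/
theorem exists_continuous_stationary [DecidableEq X] [Nonempty S] (hfull : M.FullCommunication) {ε : ℝ}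
    (hε : 0 < ε) : ∃ m : M.perturbedStrategies ε → Gr M.Γ → ℝ,
      Continuous m ∧ ∀ σ, M.IsStationary σ.1 (m σ) := by
  choose m hm using fun σ : M.perturbedStrategies ε => exists_isStationary σ.2.1
  refine ⟨m, ?_, hm⟩
  have : CompactSpace (stdSimplex ℝ (Gr M.Γ)) :=
    isCompact_iff_compactSpace.1 (isCompact_stdSimplex ℝ _)
  refine continuous_of_isClosed_relation
    (G := {q : M.perturbedStrategies ε × stdSimplex ℝ (Gr M.Γ) |
      ∀ z', q.2.1 z' = ∑ z, M.kernel q.1.1 z' z * q.2.1 z}) ?_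
    (g := Subtype.val) continuous_subtype_val (fun σ => ⟨⟨m σ, (hm σ).1⟩, (hm σ).2⟩)
    (fun σ y hy => IsStationary.unique hfull (fun s x hx => hε.trans_le (σ.2.2 s x hx))
      ⟨y.2, hy⟩ (hm σ))
  simp only [kernel, Set.ofPred_forall]
  have hy : ∀ z, Continuous fun q : M.perturbedStrategies ε × stdSimplex ℝ (Gr M.Γ) => q.2.1 z :=
    fun z => (continuous_apply z).comp (continuous_subtype_val.comp continuous_snd)
  have hσ : ∀ s x, Continuous fun q : M.perturbedStrategies ε × stdSimplex ℝ (Gr M.Γ) =>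
      q.1.1 s x := fun s x =>
    (continuous_apply_apply s x).comp (continuous_subtype_val.comp continuous_fst)
  exact isClosed_iInter fun z' => isClosed_eq (hy z') (continuous_finsetSum _ fun z _ =>
    ((hσ _ _).mul continuous_const).mul (hy z))

/-! ### Perturbed strategies and the Bellman equation. -/

instance (s : S) : Nonempty {x // x ∈ M.Γ s} := (M.Γ_nonempty s).to_subtype

/-- The strategy that puts mass `ε` on every feasible action and distributes the remaining mass
according to `p`. -/
noncomputable def perturb [DecidableEq X] (ε : ℝ) (p : ∀ s, {x // x ∈ M.Γ s} → ℝ) (s : S) (x : X) : ℝ :=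
  if h : x ∈ M.Γ s then ε + (1 - (M.Γ s).card * ε) * p s ⟨x, h⟩ else 0

theorem perturb_apply [DecidableEq X] (ε : ℝ) (p : ∀ s, {x // x ∈ M.Γ s} → ℝ) (s : S) (x : {x // x ∈ M.Γ s}) :
    perturb ε p s x = ε + (1 - (M.Γ s).card * ε) * p s x := by
  rw [perturb, dif_pos x.2]

theorem card_mul_le_one {ε : ℝ} (hε : 0 ≤ ε) (hεX : Fintype.card X * ε ≤ 1) (s : S) :
    (M.Γ s).card * ε ≤ 1 :=
  le_trans (by gcongr; exact Finset.card_le_univ _) hεX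

theorem perturb_mem [DecidableEq X] {ε : ℝ} (hε : 0 ≤ ε) (hεX : Fintype.card X * ε ≤ 1)
    {p : ∀ s, {x // x ∈ M.Γ s} → ℝ} (hp : p ∈ simplexProduct fun s => {x // x ∈ M.Γ s}) :
    perturb ε p ∈ M.perturbedStrategies ε := by
  have hge : ∀ s, ∀ x ∈ M.Γ s, ε ≤ perturb ε p s x := by
    intro s x hx
    rw [perturb, dif_pos hx]
    have := mul_nonneg (sub_nonneg.2 (card_mul_le_one (M := M) hε hεX s)) ((hp s).1 ⟨x, hx⟩)
    linarith
  have hout : ∀ s, ∀ x, x ∉ M.Γ s → perturb ε p s x = 0 := fun s x hx => dif_neg hx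
  refine ⟨fun s => ⟨⟨fun x => ?_, ?_⟩, hout s⟩, hge⟩
  · by_cases hx : x ∈ M.Γ s
    · exact hε.trans (hge s x hx)
    · rw [hout s x hx]
  · rw [← Finset.sum_subset (Finset.subset_univ (M.Γ s)) fun x _ hx => hout s x hx,
      ← Finset.sum_coe_sort]
    simp only [perturb_apply]
    rw [Finset.sum_add_distrib, ← Finset.mul_sum, (hp s).2, Finset.sum_const, Finset.card_univ,
      Fintype.card_coe, nsmul_eq_mul]
    ring

theorem continuous_perturb [DecidableEq X] (ε : ℝ) : Continuous (perturb (M := M) ε) := by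
  refine continuous_pi fun s => continuous_pi fun x => ?_
  by_cases h : x ∈ M.Γ s
  · simp only [perturb, dif_pos h]
    fun_prop
  · simp only [perturb, dif_neg h]
    fun_prop

variable (M) in
/-- The Bellman operator of the MDP with transition function `R` in which every feasible action has
probability at least `ε`. -/
noncomputable def bellman (ε : ℝ) (R : Gr M.Γ → S → ℝ) (V : S → ℝ) (s : S) : ℝ :=
  -- Closed form of the constrained maximum: the compulsory `ε` on each action, and all remaining
  -- mass on a best one.
  ∑ x : {x // x ∈ M.Γ s}, ε * M.actionValue R V ⟨(s, x), x.2⟩ +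
    (1 - (M.Γ s).card * ε) * Finset.univ.sup' Finset.univ_nonempty
      fun x : {x // x ∈ M.Γ s} => M.actionValue R V ⟨(s, x), x.2⟩

theorem actionValue_le {R : Gr M.Γ → S → ℝ} (hR : ∀ z, R z ∈ stdSimplex ℝ S) (V W : S → ℝ)
    (z : Gr M.Γ) : M.actionValue R V z ≤ M.actionValue R W z + M.δ * dist V W := by
  have h1 : M.δ * dist V W = ∑ s', M.δ * dist V W * R z s' := by
    rw [← Finset.mul_sum, (hR z).2, mul_one]
  rw [h1, actionValue, actionValue, ← Finset.sum_add_distrib]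
  refine Finset.sum_le_sum fun s' _ => ?_
  rw [← add_mul]
  refine mul_le_mul_of_nonneg_right ?_ ((hR z).1 s')
  have h2 := (le_abs_self _).trans ((Real.dist_eq _ _).symm.le.trans (dist_le_pi_dist V W s'))
  have := mul_le_mul_of_nonneg_left h2 M.δ_nonneg
  linarith

theorem bellman_le {ε : ℝ} (hε : 0 ≤ ε) (hεX : Fintype.card X * ε ≤ 1) {R : Gr M.Γ → S → ℝ}
    (hR : ∀ z, R z ∈ stdSimplex ℝ S) (V W : S → ℝ) (s : S) :
    M.bellman ε R V s ≤ M.bellman ε R W s + M.δ * dist V W := by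
  have h1 : ∑ x : {x // x ∈ M.Γ s}, ε * M.actionValue R V ⟨(s, x), x.2⟩ ≤
      ∑ x : {x // x ∈ M.Γ s}, ε * M.actionValue R W ⟨(s, x), x.2⟩ +
        (M.Γ s).card * ε * (M.δ * dist V W) := by
    calc _ ≤ ∑ x : {x // x ∈ M.Γ s}, (ε * M.actionValue R W ⟨(s, x), x.2⟩ +
          ε * (M.δ * dist V W)) := Finset.sum_le_sum fun x _ => by
            rw [← mul_add]
            exact mul_le_mul_of_nonneg_left (actionValue_le hR V W _) hε
      _ = _ := by
        rw [Finset.sum_add_distrib, Finset.sum_const, Finset.card_univ, Fintype.card_coe,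
          nsmul_eq_mul, mul_assoc]
  have h2 : (Finset.univ.sup' Finset.univ_nonempty
        fun x : {x // x ∈ M.Γ s} => M.actionValue R V ⟨(s, x), x.2⟩) ≤
      (Finset.univ.sup' Finset.univ_nonempty
        fun x : {x // x ∈ M.Γ s} => M.actionValue R W ⟨(s, x), x.2⟩) + M.δ * dist V W := by
    refine Finset.sup'_le _ _ fun x hx => (actionValue_le hR V W _).trans ?_
    gcongr
    exact Finset.le_sup' (fun x : {x // x ∈ M.Γ s} => M.actionValue R W ⟨(s, x), x.2⟩) hx
  have h3 := mul_le_mul_of_nonneg_left h2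
    (sub_nonneg.2 (card_mul_le_one (M := M) hε hεX s))
  simp only [bellman]
  linarith

theorem contractingWith_bellman {ε : ℝ} (hε : 0 ≤ ε) (hεX : Fintype.card X * ε ≤ 1)
    {R : Gr M.Γ → S → ℝ} (hR : ∀ z, R z ∈ stdSimplex ℝ S) :
    ContractingWith ⟨M.δ, M.δ_nonneg⟩ (M.bellman ε R) := by
  refine ⟨M.δ_lt_one, LipschitzWith.of_dist_le_mul fun V W => ?_⟩
  refine (dist_pi_le_iff (mul_nonneg M.δ_nonneg dist_nonneg)).2 fun s => ?_
  rw [Real.dist_eq, abs_le]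
  have h1 := bellman_le hε hεX hR V W s
  have h2 := bellman_le hε hεX hR W V s
  rw [dist_comm W V] at h2
  change -(M.δ * dist V W) ≤ _ ∧ _ ≤ M.δ * dist V W
  constructor <;> linarith

theorem continuous_bellman (ε : ℝ) (V : S → ℝ) : Continuous fun R => M.bellman ε R V := by
  refine continuous_pi fun s => ?_
  have h : ∀ z, Continuous fun R => M.actionValue R V z := fun z => by
    simp only [actionValue]
    fun_prop
  simp only [bellman]
  refine Continuous.add (continuous_finsetSum _ fun x _ => continuous_const.mul (h _))
    (continuous_const.mul ?_)
  exact Continuous.finset_sup'_apply _ fun x _ => h _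

/-- The value function depends continuously on the transition function. -/
theorem exists_continuous_value {ε : ℝ} (hε : 0 ≤ ε) (hεX : Fintype.card X * ε ≤ 1) :
    ∃ V : {R : Gr M.Γ → S → ℝ // ∀ z, R z ∈ stdSimplex ℝ S} → S → ℝ,
      Continuous V ∧ ∀ R, M.bellman ε R.1 (V R) = V R := by
  have hc := fun R : {R : Gr M.Γ → S → ℝ // ∀ z, R z ∈ stdSimplex ℝ S} =>
    contractingWith_bellman hε hεX R.2
  refine ⟨fun R => (hc R).fixedPoint, ?_, fun R => (hc R).fixedPoint_isFixedPt⟩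
  rw [continuous_iff_continuousAt]
  intro R₀
  rw [ContinuousAt, tendsto_iff_dist_tendsto_zero]
  set V₀ := (hc R₀).fixedPoint with hV₀
  have hfix : M.bellman ε R₀.1 V₀ = V₀ := (hc R₀).fixedPoint_isFixedPt
  -- The modulus `δ` is the same for all `R`, so the distance of the fixed points is controlled by
  -- moving `V₀` once; continuity in `R` at the single function `V₀` is enough.
  have hlim : Tendsto (fun R : {R : Gr M.Γ → S → ℝ // ∀ z, R z ∈ stdSimplex ℝ S} =>
      dist V₀ (M.bellman ε R.1 V₀) / (1 - M.δ)) (𝓝 R₀) (𝓝 0) := by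
    have : Continuous (fun R : {R : Gr M.Γ → S → ℝ // ∀ z, R z ∈ stdSimplex ℝ S} =>
        dist V₀ (M.bellman ε R.1 V₀) / (1 - M.δ)) :=
      (continuous_const.dist ((continuous_bellman ε V₀).comp continuous_subtype_val)).div_const _
    convert this.tendsto R₀ using 2
    rw [hfix, dist_self, zero_div]
  refine squeeze_zero (fun _ => dist_nonneg) (fun R => ?_) hlim
  rw [dist_comm]
  exact (hc R).dist_fixedPoint_le V₀

theorem mixedValue_le_bellman {ε : ℝ} (R : Gr M.Γ → S → ℝ) (V : S → ℝ) {τ : S → X → ℝ}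
    (hτ : τ ∈ M.perturbedStrategies ε) (s : S) :
    M.mixedValue R V τ s ≤ M.bellman ε R V s := by
  set B := Finset.univ.sup' Finset.univ_nonempty
      fun x : {x // x ∈ M.Γ s} => M.actionValue R V ⟨(s, x), x.2⟩ with hB
  calc M.mixedValue R V τ s
      ≤ ∑ x : {x // x ∈ M.Γ s}, (ε * M.actionValue R V ⟨(s, x), x.2⟩ + (τ s x - ε) * B) := by
        refine Finset.sum_le_sum fun x hx => ?_
        have h1 := Finset.le_sup'
          (fun x : {x // x ∈ M.Γ s} => M.actionValue R V ⟨(s, x), x.2⟩) hx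
        have h2 := mul_le_mul_of_nonneg_left h1 (sub_nonneg.2 (hτ.2 s x x.2))
        simp only [← hB] at h2
        linarith
    _ = M.bellman ε R V s := by
        rw [Finset.sum_add_distrib, ← Finset.sum_mul, Finset.sum_sub_distrib, sum_strategy hτ.1,
          Finset.sum_const, Finset.card_univ, Fintype.card_coe, nsmul_eq_mul, bellman]

/-- A mean that is at least every action value equals the largest one, so the free mass earns the
maximum. -/
theorem mixedValue_perturb [DecidableEq X] (ε : ℝ) (R : Gr M.Γ → S → ℝ) (V : S → ℝ)
    {p : ∀ s, {x // x ∈ M.Γ s} → ℝ} (hp : p ∈ simplexProduct fun s => {x // x ∈ M.Γ s}) (s : S)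
    (hbest : ∀ y : {x // x ∈ M.Γ s}, M.actionValue R V ⟨(s, y), y.2⟩ ≤
      ∑ x : {x // x ∈ M.Γ s}, p s x * M.actionValue R V ⟨(s, x), x.2⟩) :
    M.mixedValue R V (perturb ε p) s = M.bellman ε R V s := by
  set B := Finset.univ.sup' Finset.univ_nonempty
      fun x : {x // x ∈ M.Γ s} => M.actionValue R V ⟨(s, x), x.2⟩ with hB
  have hpB : ∑ x : {x // x ∈ M.Γ s}, p s x * M.actionValue R V ⟨(s, x), x.2⟩ = B := by
    refine le_antisymm ?_ (Finset.sup'_le _ _ fun x _ => hbest x)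
    calc _ ≤ ∑ x, p s x * B := Finset.sum_le_sum fun x hx =>
          mul_le_mul_of_nonneg_left (Finset.le_sup'
            (fun x : {x // x ∈ M.Γ s} => M.actionValue R V ⟨(s, x), x.2⟩) hx) ((hp s).1 x)
      _ = B := by rw [← Finset.sum_mul, (hp s).2, one_mul]
  simp only [mixedValue, bellman, perturb_apply]
  rw [← hB, ← hpB, Finset.mul_sum, ← Finset.sum_add_distrib]
  exact Finset.sum_congr rfl fun x _ => by ring

theorem isCompact_strategies : IsCompact M.strategies := by
  have h : IsCompact (Set.univ.pi fun _ : S => stdSimplex ℝ X) :=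
    isCompact_univ_pi fun _ => isCompact_stdSimplex ℝ X
  refine h.of_isClosed_subset ?_ fun σ hσ s _ => (hσ s).1
  have : M.strategies = ⋂ s, ({σ | σ s ∈ stdSimplex ℝ X} ∩
      ⋂ x, ⋂ (_ : x ∉ M.Γ s), {σ | σ s x = 0}) := by
    ext σ
    simp [strategies]
  rw [this]
  refine isClosed_iInter fun s => IsClosed.inter
    ((isClosed_stdSimplex ℝ X).preimage (continuous_apply s)) ?_
  exact isClosed_iInter fun x => isClosed_iInter fun _ =>
    isClosed_eq (by fun_prop) continuous_const

end MDP

/-! ### Beliefs, closest parameters and perturbed equilibria. -/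

namespace SMDP

variable {S X : Type*} [Fintype S] [Fintype X] {k : ℕ} {P : SMDP S X k}

variable (P) in
/-- The degenerate belief at `θ`. -/
noncomputable def diracBelief (θ : P.Θ) : ProbabilityMeasure P.Θ :=
  ⟨Measure.dirac θ, inferInstance⟩

theorem meanQ_diracBelief (θ : P.Θ) : P.meanQ (P.diracBelief θ) = P.Qθ θ := by
  funext z s'
  exact integral_dirac _ θ

theorem exhaustiveLearning_diracBelief (θ : P.Θ) : P.ExhaustiveLearning (P.diracBelief θ) := by
  classical
  intro z s' hpos A hA
  rw [bayes]
  rw [meanQ_diracBelief] at hpos ⊢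
  have h : ((P.diracBelief θ : ProbabilityMeasure P.Θ) : Measure P.Θ) = Measure.dirac θ := rfl
  rw [h, setIntegral_dirac, measureReal_def, Measure.dirac_apply' _ hA]
  by_cases hθ : θ ∈ A
  · simp [hθ, hpos.ne']
  · simp [hθ]

variable [DecidableEq X]

variable (P) in
/-- The weighted likelihood `∏ Q_θ(s' | s, x) ^ (m(s, x) Q(s' | s, x))`. -/
noncomputable def likelihood (m : Gr P.Γ → ℝ) (θ : P.Θ) : ℝ :=
  ∏ z, ∏ s', P.Qθ θ z s' ^ (m z * P.Q z s')

variable (P) in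
/-- `Q_θ` is positive wherever `Q` is. -/
def Explains (θ : P.Θ) : Prop :=
  ∀ z s', 0 < P.Q z s' → 0 < P.Qθ θ z s'

/-- Up to a factor independent of `θ` this is the exponential of minus the divergence. It trades the
value ∞ for 0, so a real-valued function can be maximized instead. Where `Q` vanishes the real power
is `x ^ 0 = 1`, even at `x = 0`. -/
theorem likelihood_eq_exp {m : Gr P.Γ → ℝ} {θ : P.Θ} (h : P.Explains θ) :
    P.likelihood m θ = Real.exp (∑ z, ∑ s', m z * P.Q z s' * Real.log (P.Qθ θ z s')) := by
  rw [Real.exp_sum]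
  refine Finset.prod_congr rfl fun z _ => ?_
  rw [Real.exp_sum]
  refine Finset.prod_congr rfl fun s' _ => ?_
  rcases ((P.Q_mem z).1 s').eq_or_lt with h0 | h0
  · simp [← h0]
  · rw [Real.rpow_def_of_pos (h z s' h0), mul_comm]

theorem explains_of_likelihood_pos {m : Gr P.Γ → ℝ} (hm : ∀ z, 0 < m z) {θ : P.Θ}
    (h : 0 < P.likelihood m θ) : P.Explains θ := by
  intro z s' hQ
  refine lt_of_le_of_ne ((P.Qθ_mem θ z).1 s') fun h0 => ?_
  have h1 := Finset.prod_ne_zero_iff.1 h.ne' z (Finset.mem_univ z)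
  have h2 := Finset.prod_ne_zero_iff.1 h1 s' (Finset.mem_univ s')
  rw [← h0, Real.zero_rpow (mul_pos (hm z) hQ).ne'] at h2
  exact h2 rfl

theorem wKLD_eq_coe {m : Gr P.Γ → ℝ} {θ : P.Θ} (h : P.Explains θ) :
    P.wKLD m θ = ((∑ z, ∑ s', m z * P.Q z s' * Real.log (P.Q z s') -
      ∑ z, ∑ s', m z * P.Q z s' * Real.log (P.Qθ θ z s') : ℝ) : EReal) := by
  have hkl : ∀ z, klDivergence (P.Q z) (P.Qθ θ z) * (m z : EReal) =
      ((∑ s', m z * P.Q z s' * Real.log (P.Q z s') -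
        ∑ s', m z * P.Q z s' * Real.log (P.Qθ θ z s') : ℝ) : EReal) := by
    intro z
    rw [klDivergence, if_neg (by rintro ⟨s, h1, h2⟩; exact (h z s h1).ne' h2), ← EReal.coe_mul,
      ← Finset.sum_sub_distrib, Finset.sum_mul]
    congr 1
    refine Finset.sum_congr rfl fun s' _ => ?_
    rcases ((P.Q_mem z).1 s').eq_or_lt with h0 | h0
    · simp [← h0]
    · rw [Real.log_div h0.ne' (h z s' h0).ne']
      ring
  rw [wKLD, Finset.sum_congr rfl fun z _ => hkl z, ← Finset.sum_sub_distrib]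
  exact (map_sum (⟨⟨Real.toEReal, EReal.coe_zero⟩, EReal.coe_add⟩ : ℝ →+ EReal) _ _).symm

/-- One summand is `⊤`; as `⊤ + ⊥ = ⊥` in `EReal`, the others must be kept away from `⊥`. -/
theorem wKLD_eq_top {m : Gr P.Γ → ℝ} (hm : ∀ z, 0 < m z) {θ : P.Θ} (h : ¬ P.Explains θ) :
    P.wKLD m θ = ⊤ := by
  have hbot : ∀ z, klDivergence (P.Q z) (P.Qθ θ z) * (m z : EReal) ≠ ⊥ := by
    intro z
    rw [klDivergence]
    split_ifs
    · rw [EReal.top_mul_coe_of_pos (hm z)]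
      simp
    · rw [← EReal.coe_mul]
      exact EReal.coe_ne_bot _
  have hsum : ∀ s : Finset (Gr P.Γ),
      ∑ z ∈ s, klDivergence (P.Q z) (P.Qθ θ z) * (m z : EReal) ≠ ⊥ := by
    intro s
    induction s using Finset.cons_induction with
    | empty => simp
    | cons z s hz ih =>
      rw [Finset.sum_cons]
      exact EReal.add_ne_bot_iff.2 ⟨hbot z, ih⟩
  classical
  simp only [Explains, not_forall, not_lt] at h
  obtain ⟨z, s', hQ, hle⟩ := h
  rw [wKLD, ← Finset.add_sum_erase _ _ (Finset.mem_univ z), klDivergence,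
    if_pos ⟨s', hQ, le_antisymm hle ((P.Qθ_mem θ z).1 s')⟩, EReal.top_mul_coe_of_pos (hm z),
    EReal.top_add_of_ne_bot (hsum _)]

/-- Against a distribution with full support, maximizers of the weighted likelihood minimize the
weighted Kullback-Leibler divergence. -/
theorem mem_closestParams_of_forall_likelihood_le {m : Gr P.Γ → ℝ} (hm : ∀ z, 0 < m z) {θ : P.Θ}
    (h : ∀ θ', P.likelihood m θ' ≤ P.likelihood m θ) : θ ∈ P.closestParams m := by
  intro θ'
  by_cases hθ' : P.Explains θ'
  · have hle := h θ'
    have hpos : 0 < P.likelihood m θ' := by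
      rw [likelihood_eq_exp hθ']
      exact Real.exp_pos _
    have hθ := explains_of_likelihood_pos hm (hpos.trans_le hle)
    rw [likelihood_eq_exp hθ, likelihood_eq_exp hθ', Real.exp_le_exp] at hle
    rw [wKLD_eq_coe hθ, wKLD_eq_coe hθ', EReal.coe_le_coe_iff]
    linarith
  · rw [wKLD_eq_top hm hθ']
    exact le_top

/-- Full support keeps the exponents positive where `Q > 0`, so the powers are continuous even where
`Q_θ` vanishes; elsewhere the exponent is constantly 0. -/
theorem continuous_likelihood (hreg : P.IsRegular) {A : Type*} [TopologicalSpace A]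
    {m : A → Gr P.Γ → ℝ} (hm : Continuous m) (hpos : ∀ a z, 0 < m a z) :
    Continuous fun q : A × P.Θ => P.likelihood (m q.1) q.2 := by
  refine continuous_finsetProd _ fun z _ => continuous_finsetProd _ fun s' _ => ?_
  rcases ((P.Q_mem z).1 s').eq_or_lt with h0 | h0
  · simp only [← h0, mul_zero, Real.rpow_zero]
    exact continuous_const
  · refine Continuous.rpow ((hreg.continuous z s').comp continuous_snd)
      ((((continuous_apply z).comp hm).comp continuous_fst).mul continuous_const) fun q => ?_
    exact Or.inr (mul_pos (hpos q.1 z) h0)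

/-- Under weak identification, the transition function of the closest parameter values depends
continuously on the distribution, as long as the latter has full support. -/
theorem exists_continuous_closest (hreg : P.IsRegular) (hweak : P.WeaklyIdentified)
    {A : Type*} [TopologicalSpace A] {m : A → Gr P.Γ → ℝ} (hm : Continuous m)
    (hmem : ∀ a, m a ∈ stdSimplex ℝ (Gr P.Γ)) (hpos : ∀ a z, 0 < m a z) :
    ∃ θ : A → P.Θ, (∀ a, θ a ∈ P.closestParams (m a)) ∧ Continuous fun a => P.Qθ (θ a) := by
  have : CompactSpace P.Θ := isCompact_iff_compactSpace.1 hreg.isCompact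
  have : Nonempty P.Θ := P.Θ_nonempty.to_subtype
  have hL := continuous_likelihood hreg hm hpos
  have hex : ∀ a, ∃ θ : P.Θ, ∀ θ', P.likelihood (m a) θ' ≤ P.likelihood (m a) θ := by
    intro a
    obtain ⟨θ, -, hθ⟩ := isCompact_univ.exists_isMaxOn (Set.univ_nonempty (α := P.Θ))
      (hL.comp (Continuous.prodMk_right a)).continuousOn
    exact ⟨θ, fun θ' => hθ (Set.mem_univ θ')⟩
  choose θ hθ using hex
  have hclosest := fun a => mem_closestParams_of_forall_likelihood_le (hpos a) (hθ a)
  refine ⟨θ, hclosest, ?_⟩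
  refine continuous_of_isClosed_relation
    (G := {q : A × P.Θ | ∀ θ', P.likelihood (m q.1) θ' ≤ P.likelihood (m q.1) q.2}) ?_
    (g := P.Qθ) (continuous_pi fun z => continuous_pi fun s' => hreg.continuous z s')
    (fun a => ⟨θ a, hθ a⟩) fun a θ' hθ' => ?_
  · simp only [Set.ofPred_forall]
    exact isClosed_iInter fun θ' =>
      isClosed_le (hL.comp (continuous_fst.prodMk continuous_const)) hL
  · funext z
    exact hweak (m a) (hmem a) _ (mem_closestParams_of_forall_likelihood_le (hpos a) hθ') _
      (hclosest a) z (hpos a z)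

/-- Existence of Berk-Nash equilibria with exhaustive learning in perturbed problems. -/
theorem exists_isBerkNashExhaustive [Nonempty S] (hreg : P.IsRegular)
    (hweak : P.WeaklyIdentified) (hfull : P.FullCommunication) {ε : ℝ} (hε : 0 < ε)
    (hεX : Fintype.card X * ε ≤ 1) :
    ∃ σ m, P.IsBerkNashExhaustive ε σ m := by
  obtain ⟨m, hmc, hm⟩ := MDP.exists_continuous_stationary hfull hε
  have hpos : ∀ σ z, 0 < m σ z := fun σ =>
    (hm σ).pos hfull fun s x hx => hε.trans_le (σ.2.2 s x hx)
  obtain ⟨θ, hθ, hθc⟩ := exists_continuous_closest hreg hweak hmc (fun σ => (hm σ).1) hpos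
  obtain ⟨V, hVc, hV⟩ := MDP.exists_continuous_value (M := P.toMDP) hε.le hεX
  let σ : simplexProduct (fun s => {x // x ∈ P.Γ s}) → P.perturbedStrategies ε := fun p =>
    ⟨MDP.perturb ε p.1, MDP.perturb_mem hε.le hεX p.2⟩
  have hσ : Continuous σ :=
    Continuous.subtype_mk ((MDP.continuous_perturb ε).comp continuous_subtype_val) _
  let R : simplexProduct (fun s => {x // x ∈ P.Γ s}) →
      {R : Gr P.Γ → S → ℝ // ∀ z, R z ∈ stdSimplex ℝ S} := fun p =>
    ⟨P.Qθ (θ (σ p)), P.Qθ_mem _⟩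
  have hR : Continuous R := Continuous.subtype_mk (hθc.comp hσ) _
  -- Model and value are those generated by the profile `p` itself, so a Nash profile for these
  -- payoffs closes the loop.
  have hA : Continuous fun p s (x : {x // x ∈ P.Γ s}) =>
      P.actionValue (R p).1 (V (R p)) ⟨(s, x), x.2⟩ := by
    have hV' : ∀ s', Continuous fun p => V (R p) s' := fun s' =>
      (continuous_apply s').comp (hVc.comp hR)
    have hR' : ∀ z s', Continuous fun p => (R p).1 z s' := fun z s' =>
      (continuous_apply_apply z s').comp (continuous_subtype_val.comp hR)
    refine continuous_pi fun s => continuous_pi fun x => ?_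
    exact continuous_finsetSum _ fun s' _ =>
      (continuous_const.add (continuous_const.mul (hV' s'))).mul (hR' _ s')
  obtain ⟨p, hp⟩ := exists_nash_simplexProduct hA
  have hval : ∀ s, P.mixedValue (R p).1 (V (R p)) (σ p).1 s = V (R p) s := fun s =>
    (MDP.mixedValue_perturb ε _ _ p.2 s (hp s)).trans (congrFun (hV (R p)) s)
  refine ⟨(σ p).1, m (σ p), P.diracBelief (θ (σ p)), ⟨⟨(σ p).2, V (R p), fun s => ⟨?_, ?_⟩, ?_⟩,
    ?_, hm (σ p)⟩, exhaustiveLearning_diracBelief _⟩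
  · rw [meanQ_diracBelief]
    exact ⟨(σ p).1, (σ p).2, hval s⟩
  · rw [meanQ_diracBelief]
    rintro _ ⟨τ, hτ, rfl⟩
    exact (MDP.mixedValue_le_bellman _ _ hτ s).trans (congrFun (hV (R p)) s).le
  · rw [meanQ_diracBelief]
    exact hval
  · change ∀ᵐ θ' ∂(Measure.dirac (θ (σ p))), θ' ∈ P.closestParams (m (σ p))
    rw [ae_dirac_eq]
    exact hθ (σ p)

end SMDP

/-! ### Passage to the limit. -/

theorem theorem3 {S X : Type*} [Fintype S] [Nonempty S] [Fintype X] [Nonempty X] [DecidableEq X]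
    {k : ℕ} (P : SMDP S X k) (hreg : P.IsRegular) (hweak : P.WeaklyIdentified)
    (hfull : P.FullCommunication) :
    ∃ (σ : S → X → ℝ) (m : Gr P.Γ → ℝ), P.IsPerfectBerkNash σ m := by
  have hX : (0 : ℝ) < Fintype.card X := by exact_mod_cast Fintype.card_pos
  -- At most `1 / |X|`, so that mass `ε n` fits on every feasible action.
  let ε : ℕ → ℚ := fun n => 1 / (n + 1) / Fintype.card X
  have hε : ∀ n, 0 < ε n := fun n => by positivity
  have hεX : ∀ n, Fintype.card X * (ε n : ℝ) ≤ 1 := by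
    intro n
    simp only [ε]
    push_cast
    rw [mul_div_cancel₀ _ hX.ne', div_le_one (by positivity)]
    linarith [(Nat.cast_nonneg n : (0 : ℝ) ≤ n)]
  have hε0 : Tendsto ε atTop (𝓝 0) := by
    have := (tendsto_one_div_add_atTop_nhds_zero_nat (𝕜 := ℚ)).div_const (Fintype.card X : ℚ)
    rwa [zero_div] at this
  choose σ m h using fun n => SMDP.exists_isBerkNashExhaustive hreg hweak hfull
    (ε := (ε n : ℝ)) (by exact_mod_cast hε n) (hεX n)
  have hmem : ∀ n, (σ n, m n) ∈ P.strategies ×ˢ stdSimplex ℝ (Gr P.Γ) := by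
    intro n
    obtain ⟨μ, hμ, -⟩ := h n
    exact ⟨hμ.optimal.1.1, hμ.stationary.1⟩
  obtain ⟨⟨σ₀, m₀⟩, hlim, φ, hφ, htend⟩ :=
    (MDP.isCompact_strategies.prod (isCompact_stdSimplex ℝ (Gr P.Γ))).tendsto_subseq hmem
  exact ⟨σ₀, m₀, hlim.1, hlim.2, ε ∘ φ, σ ∘ φ, m ∘ φ, fun n => hε _, hε0.comp hφ.tendsto_atTop,
    fun n => h _, (continuous_fst.tendsto _).comp htend, (continuous_snd.tendsto _).comp htend⟩
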